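/- Let $\Bbbk$ be an algebraically closed field of characteristic zero, $\Bbbk^*=\Bbbk\setminus\{0\}$, and let $q\in\Bbbk^*$ be not a root of unity. Let $D_q$ be the Heisenberg double of the quantum Euclidean group, i.e. the $\Bbbk$-algebra generated by $a,a^{-1},b,c,K,K^{-1},E,F$ subject to the defining relations $$\begin{aligned} &ab=qba,\quad ac=qca,\quad bc=cb,\quad aa^{-1}=a^{-1}a=1,\\ &KE=q^2EK,\quad KF=q^{-2}FK,\quad EF=FE,\quad KK^{-1}=K^{-1}K=1,\\ &Ka=q^{-1}aK,\quad Kb=qbK,\quad Kc=q^{-1}cK,\\ &Ea=aE,\quad Eb=bE,\quad Ec=cE+a^{-1}K,\\ &Fa=qaF,\quad Fb=q^{-1}bF+a,\quad Fc=qcF. \end{aligned}$$ Modules are left modules. For a $D_q$-module $V$ and $\mu\in\Bbbk^*$ put $V_\mu=\{v\in V\mid av=\mu v\}$ and $\operatorname{supp}_a(V)=\{\mu\in\Bbbk^*\mid V_\mu\neq 0\}$; $V$ is an $a$-weight module if $V=\bigoplus_{\mu\in\Bbbk^*}V_\mu$. For $x\in D_q$ let $C(x,D_q)=\{d\in D_q\mid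 dx=xd\}$, and put $\mathscr A=C(a,D_q)$. Let $\tau_K$ be the automorphism $t\mapsto K^{-1}tK$ of $\mathscr A$. For an automorphism $\sigma$ of $\mathscr A$ and an $\mathscr A$-module $M$, let $M^{\sigma}$ be the abelian group $M$ on which $t\in\mathscr A$ acts as $\sigma(t)$. 1. Let $V$ be a simple $a$-weight $D_q$-module. Then $\operatorname{supp}_a(V)$ is non-empty, $\operatorname{supp}_a(V)=\{q^i\mu\mid i\in\mathbb Z\}$ for every $\mu\in\operatorname{supp}_a(V)$, and $V_\mu$ is infinite-dimensional over $\Bbbk$ for every $\mu\in\operatorname{supp}_a(V)$. 2. The $\Bbbk$-algebras $\mathscr A=C(a,D_q)$ and $C(K,D_q)$ are isomorphic. 3. The assignment $M\mapsto \operatorname{ind}(M):=D_q\otimes_{\mathscr A}M$ defines a surjection from the set of isomorphism classes of simple $\mathscr A$-modules onto the set of isomorphism classes of simple $a$-weight $D_q$-modules: $\operatorname{ind}(M)$ is a simple $a$-weight $D_q$-module for every simple $\mathscr A$-module $M$, and every simple $a$-weight $D_q$-module is isomorphic to $\operatorname{ind}(M)$ for some simple $\mathscr A$-module $M$. Moreover,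 for simple $\mathscr A$-modules $M,M'$, one has $\operatorname{ind}(M)\simeq\operatorname{ind}(M')$ as $D_q$-modules if and only if $M'\simeq M^{\tau_K^i}$ as $\mathscr A$-modules for some $i\in\mathbb Z$. -/

import Mathlib

open scoped TensorProduct

universe u v

namespace HeisenbergDouble

/-- The eight generators `a, a⁻¹, b, c, K, K⁻¹, E, F`. -/
inductive Gen : Type
  | a | ainv | b | c | K | Kinv | E | F

section Algebra

variable (k : Type u) [Field k] (q : kˣ)

/-- A generator, as an element of the free algebra. -/
abbrev gen (x : Gen) : FreeAlgebra k Gen := FreeAlgebra.ι k x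

/-- The defining relations of `D_q(E₂)`. -/
inductive Rel : FreeAlgebra k Gen → FreeAlgebra k Gen → Prop
  | ab : Rel (gen k .a * gen k .b) ((q : k) • (gen k .b * gen k .a))
  | ac : Rel (gen k .a * gen k .c) ((q : k) • (gen k .c * gen k .a))
  | bc : Rel (gen k .b * gen k .c) (gen k .c * gen k .b)
  | a_ainv : Rel (gen k .a * gen k .ainv) 1
  | ainv_a : Rel (gen k .ainv * gen k .a) 1
  | KE : Rel (gen k .K * gen k .E) (((q ^ 2 : kˣ) : k) • (gen k .E * gen k .K))
  | KF : Rel (gen k .K * gen k .F) (((q ^ (-2 : ℤ) : kˣ) : k) • (gen k .F * gen k .K))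
  | EF : Rel (gen k .E * gen k .F) (gen k .F * gen k .E)
  | K_Kinv : Rel (gen k .K * gen k .Kinv) 1
  | Kinv_K : Rel (gen k .Kinv * gen k .K) 1
  | Ka : Rel (gen k .K * gen k .a) (((q⁻¹ : kˣ) : k) • (gen k .a * gen k .K))
  | Kb : Rel (gen k .K * gen k .b) ((q : k) • (gen k .b * gen k .K))
  | Kc : Rel (gen k .K * gen k .c) (((q⁻¹ : kˣ) : k) • (gen k .c * gen k .K))
  | Ea : Rel (gen k .E * gen k .a) (gen k .a * gen k .E)
  | Eb : Rel (gen k .E * gen k .b) (gen k .b * gen k .E)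
  | Ec : Rel (gen k .E * gen k .c) (gen k .c * gen k .E + gen k .ainv * gen k .K)
  | Fa : Rel (gen k .F * gen k .a) ((q : k) • (gen k .a * gen k .F))
  | Fb : Rel (gen k .F * gen k .b) (((q⁻¹ : kˣ) : k) • (gen k .b * gen k .F) + gen k .a)
  | Fc : Rel (gen k .F * gen k .c) ((q : k) • (gen k .c * gen k .F))

/-- The Heisenberg double `D_q = D_q(E₂)` of the quantum Euclidean group: the `k`-algebra
presented by the generators `Gen` and the relations `Rel`. -/
def Dq : Type u := RingQuot (Rel k q)

instance : Ring (Dq k q) := inferInstanceAs (Ring (RingQuot (Rel k q)))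

instance : Algebra k (Dq k q) := inferInstanceAs (Algebra k (RingQuot (Rel k q)))

/-- The image of a generator in `D_q`. -/
def Dq.of (x : Gen) : Dq k q := RingQuot.mkAlgHom k (Rel k q) (gen k x)

/-- The centralizer `C(x, D_q)` of an element `x` of `D_q`. -/
abbrev C (x : Dq k q) : Subalgebra k (Dq k q) := Subalgebra.centralizer k {x}

/-- The algebra `𝒜 = C(a, D_q)`. -/
abbrev CA : Subalgebra k (Dq k q) := C k q (Dq.of k q .a)

/-- The algebra `𝒞 = C(K, D_q)`. -/
abbrev CK : Subalgebra k (Dq k q) := C k q (Dq.of k q .K)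

theorem Dq.K_mul_Kinv : Dq.of k q .K * Dq.of k q .Kinv = 1 := by
  have h := RingQuot.mkAlgHom_rel k (Rel.K_Kinv (k := k) (q := q))
  rw [map_mul, map_one] at h
  exact h

theorem Dq.Kinv_mul_K : Dq.of k q .Kinv * Dq.of k q .K = 1 := by
  have h := RingQuot.mkAlgHom_rel k (Rel.Kinv_K (k := k) (q := q))
  rw [map_mul, map_one] at h
  exact h

theorem Dq.K_mul_a :
    Dq.of k q .K * Dq.of k q .a = ((q⁻¹ : kˣ) : k) • (Dq.of k q .a * Dq.of k q .K) := by
  have h := RingQuot.mkAlgHom_rel k (Rel.Ka (k := k) (q := q))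
  rw [map_smul, map_mul, map_mul] at h
  exact h

theorem Dq.conj_a :
    (Dq.of k q .K) * Dq.of k q .a * Dq.of k q .Kinv = ((q⁻¹ : kˣ) : k) • Dq.of k q .a := by
  rw [Dq.K_mul_a, smul_mul_assoc, mul_assoc, Dq.K_mul_Kinv, mul_one]

theorem Dq.conj_a' :
    (Dq.of k q .Kinv) * Dq.of k q .a * Dq.of k q .K = (q : k) • Dq.of k q .a := by
  have h : Dq.of k q .a * Dq.of k q .K = (q : k) • (Dq.of k q .K * Dq.of k q .a) := by
    rw [Dq.K_mul_a, smul_smul, Units.mul_inv, one_smul]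
  rw [mul_assoc, h, mul_smul_comm, ← mul_assoc, Dq.Kinv_mul_K, one_mul]

theorem CA_conj_mem {t : Dq k q} (ht : t ∈ CA k q) :
    Dq.of k q .Kinv * t * Dq.of k q .K ∈ CA k q := by
  rw [Subalgebra.mem_centralizer_iff] at ht ⊢
  intro g hg
  rw [Set.mem_singleton_iff] at hg
  subst hg
  have h := ht _ rfl
  have h1 := Dq.K_mul_Kinv k q
  have h2 := Dq.Kinv_mul_K k q
  have hc := Dq.conj_a k q
  have e1 : Dq.of k q .a * (Dq.of k q .Kinv * t * Dq.of k q .K)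
      = Dq.of k q .Kinv * (Dq.of k q .K * Dq.of k q .a * Dq.of k q .Kinv) * t * Dq.of k q .K := by
    calc _ = (Dq.of k q .Kinv * Dq.of k q .K) * Dq.of k q .a *
          (Dq.of k q .Kinv * t * Dq.of k q .K) := by rw [h2, one_mul]
      _ = _ := by noncomm_ring
  have e2 : Dq.of k q .Kinv * t * Dq.of k q .K * Dq.of k q .a
      = Dq.of k q .Kinv * t * (Dq.of k q .K * Dq.of k q .a * Dq.of k q .Kinv) * Dq.of k q .K := by
    calc _ = Dq.of k q .Kinv * t * Dq.of k q .K * Dq.of k q .a *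
          (Dq.of k q .Kinv * Dq.of k q .K) := by rw [h2, mul_one]
      _ = _ := by noncomm_ring
  rw [e1, e2, hc, mul_smul_comm, mul_smul_comm, smul_mul_assoc, smul_mul_assoc, smul_mul_assoc,
    mul_assoc (Dq.of k q .Kinv), h, ← mul_assoc]

theorem CA_conj_mem' {t : Dq k q} (ht : t ∈ CA k q) :
    Dq.of k q .K * t * Dq.of k q .Kinv ∈ CA k q := by
  rw [Subalgebra.mem_centralizer_iff] at ht ⊢
  intro g hg
  rw [Set.mem_singleton_iff] at hg
  subst hg
  have h := ht _ rfl
  have h1 := Dq.K_mul_Kinv k q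
  have hc := Dq.conj_a' k q
  have e1 : Dq.of k q .a * (Dq.of k q .K * t * Dq.of k q .Kinv)
      = Dq.of k q .K * (Dq.of k q .Kinv * Dq.of k q .a * Dq.of k q .K) * t * Dq.of k q .Kinv := by
    calc _ = (Dq.of k q .K * Dq.of k q .Kinv) * Dq.of k q .a *
          (Dq.of k q .K * t * Dq.of k q .Kinv) := by rw [h1, one_mul]
      _ = _ := by noncomm_ring
  have e2 : Dq.of k q .K * t * Dq.of k q .Kinv * Dq.of k q .a
      = Dq.of k q .K * t * (Dq.of k q .Kinv * Dq.of k q .a * Dq.of k q .K) * Dq.of k q .Kinv := by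
    calc _ = Dq.of k q .K * t * Dq.of k q .Kinv * Dq.of k q .a *
          (Dq.of k q .K * Dq.of k q .Kinv) := by rw [h1, mul_one]
      _ = _ := by noncomm_ring
  rw [e1, e2, hc, mul_smul_comm, mul_smul_comm, smul_mul_assoc, smul_mul_assoc, smul_mul_assoc,
    mul_assoc (Dq.of k q .K), h, ← mul_assoc]

/-- The automorphism `τ_K : 𝒜 → 𝒜`, `t ↦ K⁻¹ t K`. -/
def tauK : CA k q ≃ₐ[k] CA k q where
  toFun t := ⟨Dq.of k q .Kinv * t * Dq.of k q .K, CA_conj_mem k q t.2⟩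
  invFun t := ⟨Dq.of k q .K * t * Dq.of k q .Kinv, CA_conj_mem' k q t.2⟩
  left_inv t := by
    apply Subtype.ext
    change Dq.of k q .K * (Dq.of k q .Kinv * t * Dq.of k q .K) * Dq.of k q .Kinv = t
    calc _ = (Dq.of k q .K * Dq.of k q .Kinv) * t * (Dq.of k q .K * Dq.of k q .Kinv) := by
          noncomm_ring
      _ = t := by rw [Dq.K_mul_Kinv, one_mul, mul_one]
  right_inv t := by
    apply Subtype.ext
    change Dq.of k q .Kinv * (Dq.of k q .K * t * Dq.of k q .Kinv) * Dq.of k q .K = t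
    calc _ = (Dq.of k q .Kinv * Dq.of k q .K) * t * (Dq.of k q .Kinv * Dq.of k q .K) := by
          noncomm_ring
      _ = t := by rw [Dq.Kinv_mul_K, one_mul, mul_one]
  map_mul' s t := by
    apply Subtype.ext
    change Dq.of k q .Kinv * (s * t : Dq k q) * Dq.of k q .K
      = (Dq.of k q .Kinv * s * Dq.of k q .K) * (Dq.of k q .Kinv * t * Dq.of k q .K)
    calc _ = Dq.of k q .Kinv * s * 1 * t * Dq.of k q .K := by noncomm_ring
      _ = Dq.of k q .Kinv * s * (Dq.of k q .K * Dq.of k q .Kinv) * t * Dq.of k q .K := by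
          rw [Dq.K_mul_Kinv]
      _ = _ := by noncomm_ring
  map_add' s t := by
    apply Subtype.ext
    change Dq.of k q .Kinv * (s + t : Dq k q) * Dq.of k q .K
      = Dq.of k q .Kinv * s * Dq.of k q .K + Dq.of k q .Kinv * t * Dq.of k q .K
    rw [mul_add, add_mul]
  commutes' r := by
    apply Subtype.ext
    change Dq.of k q .Kinv * algebraMap k (Dq k q) r * Dq.of k q .K = algebraMap k (Dq k q) r
    rw [← Algebra.commutes, mul_assoc, Dq.Kinv_mul_K, mul_one]

end Algebra

section Twist

/-- The twist `M^σ` of an `R`-module `M` by an automorphism `σ` of `R`: the same abelian group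
with `r` acting as `σ r`. -/
def Twist {k : Type*} [CommRing k] {R : Type*} [Ring R] [Algebra k R] (_σ : R ≃ₐ[k] R)
    (M : Type v) : Type v := M

variable {k : Type*} [CommRing k] {R : Type*} [Ring R] [Algebra k R] (σ : R ≃ₐ[k] R)
  (M : Type v) [AddCommGroup M] [Module R M]

instance : AddCommGroup (Twist σ M) := inferInstanceAs (AddCommGroup M)

instance : Module R (Twist σ M) := Module.compHom M (σ : R →+* R)

end Twist

section Induction

variable {k : Type u} [Field k] {D : Type u} [Ring D] [Algebra k D] (S : Subalgebra k D)
  (M : Type v) [AddCommGroup M] [Module S M]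

/-- The left `D`-submodule of `D ⊗_ℤ M` generated by all `d s ⊗ m - d ⊗ s m` with
`d ∈ D`, `s ∈ S`, `m ∈ M`. -/
def balancedRel : Submodule D (D ⊗[ℤ] M) :=
  Submodule.span D {x | ∃ (d : D) (s : S) (m : M), x = (d * (s : D)) ⊗ₜ[ℤ] m - d ⊗ₜ[ℤ] (s • m)}

/-- The induced left `D`-module `D ⊗_S M` (the tensor product over the noncommutative ring `S`). -/
def Ind : Type (max u v) := (D ⊗[ℤ] M) ⧸ balancedRel S M

instance : AddCommGroup (Ind S M) :=
  inferInstanceAs (AddCommGroup ((D ⊗[ℤ] M) ⧸ balancedRel S M))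

instance : Module D (Ind S M) :=
  inferInstanceAs (Module D ((D ⊗[ℤ] M) ⧸ balancedRel S M))

instance : Module k (Ind S M) :=
  inferInstanceAs (Module k ((D ⊗[ℤ] M) ⧸ balancedRel S M))

instance : IsScalarTower k D (Ind S M) :=
  inferInstanceAs (IsScalarTower k D ((D ⊗[ℤ] M) ⧸ balancedRel S M))

end Induction

section Weight

variable (k : Type u) [Field k] (q : kˣ) (V : Type v) [AddCommGroup V] [Module k V]
  [Module (Dq k q) V] [IsScalarTower k (Dq k q) V]

/-- The `a`-weight space `V_μ = {v ∈ V | a v = μ v}`. -/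
def weightSpace (μ : kˣ) : Submodule k V :=
  Module.End.eigenspace (Algebra.lsmul k k V (Dq.of k q .a)) (μ : k)

theorem mem_weightSpace (μ : kˣ) (x : V) :
    x ∈ weightSpace k q V μ ↔ Dq.of k q .a • x = (μ : k) • x :=
  Module.End.mem_eigenspace_iff

/-- `V` is an `a`-weight module: `V` is the direct sum of the `V_μ`, `μ ∈ kˣ`. -/
def IsAWeight : Prop :=
  open scoped Classical in DirectSum.IsInternal (weightSpace k q V)

/-- The `a`-support of `V`. -/
def supp : Set kˣ := {μ | weightSpace k q V μ ≠ ⊥}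

end Weight

end HeisenbergDouble

open HeisenbergDouble

/-! Correcting `E`, `c`, `b`, `F` by monomials in `a` and `K` cancels their weights: `e = E a²`, `y
= c K⁻¹ a⁻¹`, `z = b K⁻¹ a`, `f = F K a⁻²` commute with `a` and `K`, and `(e, y)`, `(f, z)` satisfy
quantum Weyl relations and q-commute with each other. Thus `D_q` is governed by a quantum torus `a K
= q K a` with these four elements commuting with it (`Dq.isTorusWeyl`, `IsTorusWeyl.rel`). The
quarter turn `a ↦ K`, `K ↦ a⁻¹` of the torus extends to an automorphism of `D_q`, which carries
`C(a, D_q)` onto `C(K, D_q)`.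

Conjugation by `a` grades `D_q` by `ℤ`, because `q` is not a root of unity. The degree-zero part is
`𝒜 = C(a, D_q)`, and the invertible element `K` has degree 1, so the part of degree `j` is `Kʲ 𝒜`.
Classifying weight modules is then Clifford theory: `ind(M)` is the sum of the subspaces `Kⁱ ⊗ M`,
copies of the twists of `M` by `τ_Kⁱ`, and these are exactly its weight spaces, of weights `qⁱ μ`.
Conversely a simple weight module is induced from any of its nonzero weight spaces.

This requires the central element `a` to act on a simple `𝒜`-module by a scalar, over an
algebraically closed field of any cardinality. The argument is generic freeness
(`exists_smul_eq_zero_of_monomial_family`). If no nonzero polynomial in `a` killed a vector `v`, all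
of them would act surjectively by Schur's lemma. But ordered monomials applied to `v` span the
module over `k[X]`, so after multiplication by powers of one polynomial every vector lands in a free
module having `v` in its basis; such a `v` is not divisible by every polynomial.

A nonzero weight space of finite dimension `n` is impossible: `e` and `f` would act injectively by
the quantum Weyl relations, and determinants in `e f = q⁻² f e` would give `q²ⁿ = 1`. -/

namespace HeisenbergDouble

/-! ### Universal property and defining relations of `D_q` -/

section Relations

theorem smul_comm_mul {k A : Type*} [Field k] [Ring A] [Algebra k A] {x y : A} {s : k}
    (h : x * y = s • (y * x)) (z : A) : x * (y * z) = s • (y * (x * z)) := by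
  rw [← mul_assoc, h, smul_mul_assoc, mul_assoc]

theorem cancel_mul {A : Type*} [Ring A] {x y : A} (h : x * y = 1) (z : A) : x * (y * z) = z := by
  rw [← mul_assoc, h, one_mul]

theorem comm_mul {A : Type*} [Ring A] {x y : A} (h : x * y = y * x) (z : A) :
    x * (y * z) = y * (x * z) := by
  rw [← mul_assoc, h, mul_assoc]

theorem inv_smul_comm {k A : Type*} [Field k] [Ring A] [Algebra k A] {u u' x : A} {s : k}
    (hs : s ≠ 0) (h1 : u * u' = 1) (h2 : u' * u = 1) (h : u * x = s • (x * u)) :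
    u' * x = s⁻¹ • (x * u') := by
  have : x * u' = s • (u' * x) := by
    calc x * u' = u' * (u * x) * u' := by rw [← mul_assoc, h2, one_mul]
      _ = s • (u' * x * (u * u')) := by rw [h]; simp [mul_assoc]
      _ = _ := by rw [h1, mul_one]
  rw [this, smul_smul, inv_mul_cancel₀ hs, one_smul]

variable (k : Type u) [Field k] (q : kˣ)

namespace Dq

/-- The canonical projection of the free algebra onto `D_q`. -/
def mk : FreeAlgebra k Gen →ₐ[k] Dq k q := RingQuot.mkAlgHom k (Rel k q)

theorem mk_gen (x : Gen) : mk k q (gen k x) = of k q x := rfl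

theorem mk_surjective : Function.Surjective (mk k q) := RingQuot.mkAlgHom_surjective k (Rel k q)

variable {k q} in
theorem mk_rel {x y : FreeAlgebra k Gen} (h : Rel k q x y) : mk k q x = mk k q y :=
  RingQuot.mkAlgHom_rel k h

theorem adjoin_range_of : Algebra.adjoin k (Set.range (of k q)) = ⊤ := by
  have h : Set.range (of k q) = mk k q '' Set.range (FreeAlgebra.ι k) := by
    rw [← Set.range_comp]; rfl
  rw [h, Algebra.adjoin_image, FreeAlgebra.adjoin_range_ι, Algebra.map_top,
    AlgHom.range_eq_top]
  exact mk_surjective k q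

variable {k q} in
theorem algHom_ext {B : Type*} [Ring B] [Algebra k B] {φ ψ : Dq k q →ₐ[k] B}
    (h : ∀ x, φ (of k q x) = ψ (of k q x)) : φ = ψ :=
  RingQuot.ringQuot_ext' k _ _ (FreeAlgebra.hom_ext (funext h))

/-- An algebra homomorphism out of `D_q` from images of the generators satisfying the
defining relations. -/
def lift {B : Type*} [Ring B] [Algebra k B] (g : Gen → B)
    (hg : ∀ ⦃x y⦄, Rel k q x y → FreeAlgebra.lift k g x = FreeAlgebra.lift k g y) :
    Dq k q →ₐ[k] B :=
  RingQuot.liftAlgHom k ⟨FreeAlgebra.lift k g, hg⟩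

theorem lift_of {B : Type*} [Ring B] [Algebra k B] (g : Gen → B)
    (hg : ∀ ⦃x y⦄, Rel k q x y → FreeAlgebra.lift k g x = FreeAlgebra.lift k g y) (x : Gen) :
    lift k q g hg (of k q x) = g x :=
  (RingQuot.liftAlgHom_mkAlgHom_apply k (FreeAlgebra.lift k g) hg (gen k x)).trans
    (FreeAlgebra.lift_ι_apply g x)

theorem a_ainv : of k q .a * of k q .ainv = 1 := by
  simpa [mk_gen] using mk_rel (Rel.a_ainv (k := k) (q := q))
theorem ainv_a : of k q .ainv * of k q .a = 1 := by
  simpa [mk_gen] using mk_rel (Rel.ainv_a (k := k) (q := q))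
theorem a_b : of k q .a * of k q .b = (q : k) • (of k q .b * of k q .a) := by
  simpa [mk_gen] using mk_rel (Rel.ab (k := k) (q := q))
theorem a_c : of k q .a * of k q .c = (q : k) • (of k q .c * of k q .a) := by
  simpa [mk_gen] using mk_rel (Rel.ac (k := k) (q := q))
theorem b_c : of k q .b * of k q .c = of k q .c * of k q .b := by
  simpa [mk_gen] using mk_rel (Rel.bc (k := k) (q := q))
theorem K_E : of k q .K * of k q .E = ((q : k) ^ 2) • (of k q .E * of k q .K) := by
  simpa [mk_gen] using mk_rel (Rel.KE (k := k) (q := q))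
theorem K_F : of k q .K * of k q .F = ((q : k) ^ 2)⁻¹ • (of k q .F * of k q .K) := by
  have := mk_rel (Rel.KF (k := k) (q := q))
  rw [map_smul, map_mul, map_mul, Units.val_zpow_eq_zpow_val, zpow_neg, zpow_ofNat] at this
  exact this
theorem E_F : of k q .E * of k q .F = of k q .F * of k q .E := by
  simpa [mk_gen] using mk_rel (Rel.EF (k := k) (q := q))
theorem a_K : of k q .a * of k q .K = (q : k) • (of k q .K * of k q .a) := by
  rw [K_mul_a, smul_smul, Units.mul_inv, one_smul]
theorem K_b : of k q .K * of k q .b = (q : k) • (of k q .b * of k q .K) := by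
  simpa [mk_gen] using mk_rel (Rel.Kb (k := k) (q := q))
theorem K_c : of k q .K * of k q .c = (q : k)⁻¹ • (of k q .c * of k q .K) := by
  simpa [mk_gen] using mk_rel (Rel.Kc (k := k) (q := q))
theorem a_E : of k q .a * of k q .E = of k q .E * of k q .a := by
  simpa [mk_gen] using (mk_rel (Rel.Ea (k := k) (q := q))).symm
theorem E_b : of k q .E * of k q .b = of k q .b * of k q .E := by
  simpa [mk_gen] using mk_rel (Rel.Eb (k := k) (q := q))
theorem E_c : of k q .E * of k q .c
    = of k q .c * of k q .E + of k q .ainv * of k q .K := by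
  simpa [mk_gen] using mk_rel (Rel.Ec (k := k) (q := q))
theorem a_F : of k q .a * of k q .F = (q : k)⁻¹ • (of k q .F * of k q .a) := by
  have := mk_rel (Rel.Fa (k := k) (q := q))
  rw [map_smul, map_mul, map_mul] at this
  change of k q .F * of k q .a = (q : k) • (of k q .a * of k q .F) at this
  rw [this, smul_smul, inv_mul_cancel₀ q.ne_zero, one_smul]
theorem F_b : of k q .F * of k q .b
    = (q : k)⁻¹ • (of k q .b * of k q .F) + of k q .a := by
  simpa [mk_gen] using mk_rel (Rel.Fb (k := k) (q := q))
theorem F_c : of k q .F * of k q .c = (q : k) • (of k q .c * of k q .F) := by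
  simpa [mk_gen] using mk_rel (Rel.Fc (k := k) (q := q))

end Dq

end Relations

/-! ### The quantum torus, the weight-zero generators, and the automorphism exchanging the
centralizers -/

section TorusWeyl

/-- A quantum torus `⟨a, K⟩` together with four elements commuting with it which satisfy the
relations of a twisted tensor product of two quantum Weyl algebras. -/
structure IsTorusWeyl {k B : Type*} [Field k] [Ring B] [Algebra k B] (q : kˣ)
    (a a' K K' e y z f : B) : Prop where
  aa' : a * a' = 1
  a'a : a' * a = 1
  KK' : K * K' = 1
  K'K : K' * K = 1
  aK : a * K = (q : k) • (K * a)
  ae : a * e = e * a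
  ay : a * y = y * a
  az : a * z = z * a
  af : a * f = f * a
  Ke : K * e = e * K
  Ky : K * y = y * K
  Kz : K * z = z * K
  Kf : K * f = f * K
  ey : e * y = (q : k) ^ 2 • (y * e) + 1
  fz : f * z = ((q : k) ^ 2)⁻¹ • (z * f) + (q : k) • 1
  ez : e * z = (q : k) ^ 2 • (z * e)
  ef : e * f = ((q : k) ^ 2)⁻¹ • (f * e)
  zy : z * y = (q : k) ^ 2 • (y * z)
  yf : y * f = (q : k) ^ 2 • (f * y)

namespace IsTorusWeyl

variable {k : Type u} {B : Type*} [Field k] [Ring B] [Algebra k B] {q : kˣ}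
  {a a' K K' e y z f : B} (h : IsTorusWeyl q a a' K K' e y z f)

theorem inv_comm {u u' x : B} (h1 : u * u' = 1) (h2 : u' * u = 1) (h : u * x = x * u) :
    u' * x = x * u' := by
  calc u' * x = u' * (x * u) * u' := by rw [mul_assoc, mul_assoc, h1, mul_one]
    _ = x * u' := by rw [← h, ← mul_assoc, h2, one_mul]

include h

theorem K'a : K' * a = (q : k) • (a * K') := by
  have hK : K * a = (q : k)⁻¹ • (a * K) := by
    rw [h.aK, smul_smul, inv_mul_cancel₀ q.ne_zero, one_smul]
  simpa using inv_smul_comm (inv_ne_zero q.ne_zero) h.KK' h.K'K hK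

theorem a'K : a' * K = (q : k)⁻¹ • (K * a') := inv_smul_comm q.ne_zero h.aa' h.a'a h.aK

theorem aK' : a * K' = (q : k)⁻¹ • (K' * a) := by
  rw [h.K'a, smul_smul, inv_mul_cancel₀ q.ne_zero, one_smul]

theorem a'K' : a' * K' = (q : k) • (K' * a') := by
  simpa using inv_smul_comm (inv_ne_zero q.ne_zero) h.aa' h.a'a h.aK'

theorem Ka' : K * a' = (q : k) • (a' * K) := by
  rw [h.a'K, smul_smul, mul_inv_cancel₀ q.ne_zero, one_smul]

/-- The relation `a K = q K a` is equivalent to `K a⁻¹ = q a⁻¹ K`, and the other four elements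
commute with the whole torus, so they notice nothing. Iterating the turn also yields all commutation
rules for the inverses. -/
theorem rotate : IsTorusWeyl q K K' a' a e y z f where
  aa' := h.KK'
  a'a := h.K'K
  KK' := h.a'a
  K'K := h.aa'
  aK := h.Ka'
  ae := h.Ke
  ay := h.Ky
  az := h.Kz
  af := h.Kf
  Ke := inv_comm h.aa' h.a'a h.ae
  Ky := inv_comm h.aa' h.a'a h.ay
  Kz := inv_comm h.aa' h.a'a h.az
  Kf := inv_comm h.aa' h.a'a h.af
  ey := h.ey
  fz := h.fz
  ez := h.ez
  ef := h.ef
  zy := h.zy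
  yf := h.yf

theorem a'e : a' * e = e * a' := h.rotate.Ke
theorem a'y : a' * y = y * a' := h.rotate.Ky
theorem a'z : a' * z = z * a' := h.rotate.Kz
theorem a'f : a' * f = f * a' := h.rotate.Kf
theorem K'e : K' * e = e * K' := h.rotate.a'e
theorem K'y : K' * y = y * K' := h.rotate.a'y
theorem K'z : K' * z = z * K' := h.rotate.a'z
theorem K'f : K' * f = f * K' := h.rotate.a'f

theorem fe : f * e = (q : k) ^ 2 • (e * f) := by
  rw [h.ef, smul_smul, mul_inv_cancel₀ (pow_ne_zero 2 q.ne_zero), one_smul]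
theorem ze : z * e = ((q : k) ^ 2)⁻¹ • (e * z) := by
  rw [h.ez, smul_smul, inv_mul_cancel₀ (pow_ne_zero 2 q.ne_zero), one_smul]
theorem fy : f * y = ((q : k) ^ 2)⁻¹ • (y * f) := by
  rw [h.yf, smul_smul, inv_mul_cancel₀ (pow_ne_zero 2 q.ne_zero), one_smul]
theorem ye : y * e = ((q : k) ^ 2)⁻¹ • (e * y) + (-((q : k) ^ 2)⁻¹) • 1 := by
  rw [h.ey, smul_add, smul_smul, inv_mul_cancel₀ (pow_ne_zero 2 q.ne_zero), one_smul]
  simp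

/-- The images are obtained by solving `e = E a²`, `y = c K⁻¹ a⁻¹`, `z = b K⁻¹ a`, `f = F K a⁻²` for
the original generators. Moving torus letters to the right and reordering the others reduces each
defining relation to an identity between powers of `q`. -/
theorem rel ⦃s t : FreeAlgebra k Gen⦄ (hst : Rel k q s t) :
    let g : Gen → B := fun x => match x with
      | .a => a | .ainv => a' | .b => z * a' * K | .c => y * a * K
      | .K => K | .Kinv => K' | .E => e * a' ^ 2 | .F => f * a ^ 2 * K'
    FreeAlgebra.lift k g s = FreeAlgebra.lift k g t := by
  intro g
  have hq : (q : k) ≠ 0 := q.ne_zero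
  have ey' : ∀ w, e * (y * w) = (q : k) ^ 2 • (y * (e * w)) + w := fun w => by
    rw [← mul_assoc, h.ey]; simp [add_mul, mul_assoc]
  have fz' : ∀ w, f * (z * w) = ((q : k) ^ 2)⁻¹ • (z * (f * w)) + (q : k) • w := fun w => by
    rw [← mul_assoc, h.fz]; simp [add_mul, mul_assoc]
  cases hst <;>
  simp only [map_mul, map_smul, map_add, map_one, FreeAlgebra.lift_ι_apply, g, pow_two, mul_assoc,
    h.aa', h.a'a, h.KK', h.K'K, cancel_mul h.aa', cancel_mul h.a'a, cancel_mul h.KK',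
    cancel_mul h.K'K, h.aK, h.aK', h.a'K,
    smul_comm_mul h.aK, smul_comm_mul h.aK', smul_comm_mul h.a'K, smul_comm_mul h.a'K',
    comm_mul h.ae, comm_mul h.ay, comm_mul h.az, comm_mul h.af,
    comm_mul h.Ke, comm_mul h.Ky, comm_mul h.Kz, comm_mul h.Kf,
    comm_mul h.a'e, comm_mul h.a'y, comm_mul h.a'z, comm_mul h.a'f, comm_mul h.K'y, comm_mul h.K'z,
    h.K'e, ey', fz', smul_comm_mul h.ez, smul_comm_mul h.ef, smul_comm_mul h.zy, smul_comm_mul h.yf,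
    mul_smul_comm, smul_mul_assoc, smul_smul, smul_add, mul_one,
    Units.val_zpow_eq_zpow_val, Units.val_mul, Units.val_inv_eq_inv_val]
  all_goals match_scalars <;> field_simp

end IsTorusWeyl

variable (k : Type u) [Field k] (q : kˣ)

namespace Dq

/-- The element `E a²` of `D_q`. -/
def e : Dq k q := of k q .E * of k q .a ^ 2
/-- The element `c K⁻¹ a⁻¹` of `D_q`. -/
def y : Dq k q := of k q .c * of k q .Kinv * of k q .ainv
/-- The element `b K⁻¹ a` of `D_q`. -/
def z : Dq k q := of k q .b * of k q .Kinv * of k q .a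
/-- The element `F K a⁻²` of `D_q`. -/
def f : Dq k q := of k q .F * of k q .K * of k q .ainv ^ 2

/-- The torus factors are dictated by weights: for instance `E` commutes with `a` and has weight
`q²` under conjugation by `K`, which `a²` cancels. The same factors turn the inhomogeneous terms
`a⁻¹ K` and `a` into scalars. -/
theorem isTorusWeyl : IsTorusWeyl q (of k q .a) (of k q .ainv) (of k q .K) (of k q .Kinv)
    (e k q) (y k q) (z k q) (f k q) := by
  have hq : (q : k) ≠ 0 := q.ne_zero
  have aa' := a_ainv k q
  have a'a := ainv_a k q
  have KK' := K_mul_Kinv k q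
  have K'K := Kinv_mul_K k q
  have aK := a_K k q
  have aK' : of k q .a * of k q .Kinv = (q : k)⁻¹ • (of k q .Kinv * of k q .a) := by
    have := inv_smul_comm (inv_ne_zero hq) KK' K'K (by
      rw [aK, smul_smul, inv_mul_cancel₀ hq, one_smul] :
      of k q .K * of k q .a = (q : k)⁻¹ • (of k q .a * of k q .K))
    rw [this, inv_inv, smul_smul, inv_mul_cancel₀ hq, one_smul]
  have a'K := inv_smul_comm hq aa' a'a aK
  have a'K' := inv_smul_comm (inv_ne_zero hq) aa' a'a aK'
  have ab := a_b k q
  have ac := a_c k q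
  have aE := a_E k q
  have aF := a_F k q
  have a'b := inv_smul_comm hq aa' a'a ab
  have a'c := inv_smul_comm hq aa' a'a ac
  have a'E := IsTorusWeyl.inv_comm aa' a'a aE
  have a'F := inv_smul_comm (inv_ne_zero hq) aa' a'a aF
  have Kb := K_b k q
  have Kc := K_c k q
  have KE := K_E k q
  have KF := K_F k q
  have K'b := inv_smul_comm hq KK' K'K Kb
  have K'c := inv_smul_comm (inv_ne_zero hq) KK' K'K Kc
  have K'E := inv_smul_comm (pow_ne_zero 2 hq) KK' K'K KE
  have K'F := inv_smul_comm (inv_ne_zero (pow_ne_zero 2 hq)) KK' K'K KF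
  have bc := b_c k q
  have EF := E_F k q
  have Eb := E_b k q
  have Ec : ∀ w, of k q .E * (of k q .c * w)
      = of k q .c * (of k q .E * w) + of k q .ainv * (of k q .K * w) := fun w => by
    rw [← mul_assoc, E_c]; simp only [add_mul, mul_assoc]
  have Fb : ∀ w, of k q .F * (of k q .b * w)
      = (q : k)⁻¹ • (of k q .b * (of k q .F * w)) + of k q .a * w := fun w => by
    rw [← mul_assoc, F_b]; simp only [add_mul, mul_assoc, smul_mul_assoc]
  have Fc := F_c k q
  constructor
  case aa' => exact aa'
  case a'a => exact a'a
  case KK' => exact KK'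
  case K'K => exact K'K
  case aK => exact aK
  all_goals
    simp only [e, y, z, f, pow_two, mul_assoc,
      aa', a'a, cancel_mul aa', cancel_mul a'a, cancel_mul KK', cancel_mul K'K,
      aK, aK', a'K, KE, a'K', smul_comm_mul aK, smul_comm_mul aK', smul_comm_mul a'K,
      smul_comm_mul a'K', smul_comm_mul ab, smul_comm_mul ac, comm_mul aE, smul_comm_mul aF,
      smul_comm_mul a'b, smul_comm_mul a'c, comm_mul a'E, smul_comm_mul a'F,
      smul_comm_mul Kb, smul_comm_mul Kc, smul_comm_mul KE, smul_comm_mul KF,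
      smul_comm_mul K'b, smul_comm_mul K'c, smul_comm_mul K'E, smul_comm_mul K'F,
      comm_mul bc, comm_mul EF, comm_mul Eb, Ec, Fb, smul_comm_mul Fc,
      mul_smul_comm, smul_smul, smul_add, mul_one]
  all_goals match_scalars <;> field_simp

theorem E_eq : of k q .E = e k q * of k q .ainv ^ 2 := by
  simp only [e, pow_two, mul_assoc, cancel_mul (a_ainv k q), a_ainv, mul_one]

theorem c_eq : of k q .c = y k q * of k q .a * of k q .K := by
  simp only [y, mul_assoc, cancel_mul (ainv_a k q), Kinv_mul_K, mul_one]

theorem b_eq : of k q .b = z k q * of k q .ainv * of k q .K := by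
  simp only [z, mul_assoc, cancel_mul (a_ainv k q), Kinv_mul_K, mul_one]

theorem F_eq : of k q .F = f k q * of k q .a ^ 2 * of k q .Kinv := by
  simp only [f, pow_two, mul_assoc, cancel_mul (ainv_a k q), K_mul_Kinv, mul_one]

end Dq

namespace IsTorusWeyl

variable {k q} {B : Type*} [Ring B] [Algebra k B] {a a' K K' e y z f : B}
  (h : IsTorusWeyl q a a' K K' e y z f)

/-- The algebra homomorphism from `D_q` attached to a quantum torus with commuting quantum Weyl
algebras. -/
def toAlgHom : Dq k q →ₐ[k] B := Dq.lift k q _ h.rel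

theorem toAlgHom_a : h.toAlgHom (Dq.of k q .a) = a := Dq.lift_of ..
theorem toAlgHom_ainv : h.toAlgHom (Dq.of k q .ainv) = a' := Dq.lift_of ..
theorem toAlgHom_K : h.toAlgHom (Dq.of k q .K) = K := Dq.lift_of ..
theorem toAlgHom_Kinv : h.toAlgHom (Dq.of k q .Kinv) = K' := Dq.lift_of ..
theorem toAlgHom_E : h.toAlgHom (Dq.of k q .E) = e * a' ^ 2 := Dq.lift_of ..
theorem toAlgHom_F : h.toAlgHom (Dq.of k q .F) = f * a ^ 2 * K' := Dq.lift_of ..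
theorem toAlgHom_b : h.toAlgHom (Dq.of k q .b) = z * a' * K := Dq.lift_of ..
theorem toAlgHom_c : h.toAlgHom (Dq.of k q .c) = y * a * K := Dq.lift_of ..

theorem toAlgHom_e : h.toAlgHom (Dq.e k q) = e := by
  simp only [Dq.e, map_mul, toAlgHom_a, toAlgHom_E, pow_two, mul_assoc,
    cancel_mul h.a'a, h.a'a, mul_one]
theorem toAlgHom_y : h.toAlgHom (Dq.y k q) = y := by
  simp only [Dq.y, map_mul, toAlgHom_ainv, toAlgHom_Kinv, toAlgHom_c, mul_assoc,
    cancel_mul h.KK', h.aa', mul_one]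
theorem toAlgHom_z : h.toAlgHom (Dq.z k q) = z := by
  simp only [Dq.z, map_mul, toAlgHom_a, toAlgHom_Kinv, toAlgHom_b, mul_assoc,
    cancel_mul h.KK', h.a'a, mul_one]
theorem toAlgHom_f : h.toAlgHom (Dq.f k q) = f := by
  simp only [Dq.f, map_mul, toAlgHom_ainv, toAlgHom_K, toAlgHom_F, pow_two, mul_assoc,
    cancel_mul h.aa', cancel_mul h.K'K, h.aa', mul_one]

end IsTorusWeyl

namespace Dq

/-- The automorphism of `D_q` with `a ↦ K`, `K ↦ a⁻¹` that fixes `E a²`, `c K⁻¹ a⁻¹`, `b K⁻¹ a`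
and `F K a⁻²`. -/
def rotation : Dq k q ≃ₐ[k] Dq k q :=
  AlgEquiv.ofAlgHom (isTorusWeyl k q).rotate.toAlgHom
    -- The quarter turn has order four, so its cube is its inverse.
    (isTorusWeyl k q).rotate.rotate.rotate.toAlgHom
    (algHom_ext fun x => by
      cases x <;> simp only [AlgHom.comp_apply, AlgHom.id_apply, map_mul, map_pow,
        IsTorusWeyl.toAlgHom_a, IsTorusWeyl.toAlgHom_ainv, IsTorusWeyl.toAlgHom_K,
        IsTorusWeyl.toAlgHom_Kinv, IsTorusWeyl.toAlgHom_E, IsTorusWeyl.toAlgHom_F,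
        IsTorusWeyl.toAlgHom_b, IsTorusWeyl.toAlgHom_c, IsTorusWeyl.toAlgHom_e,
        IsTorusWeyl.toAlgHom_f, IsTorusWeyl.toAlgHom_y, IsTorusWeyl.toAlgHom_z,
        ← E_eq, ← F_eq, ← b_eq, ← c_eq])
    (algHom_ext fun x => by
      cases x <;> simp only [AlgHom.comp_apply, AlgHom.id_apply, map_mul, map_pow,
        IsTorusWeyl.toAlgHom_a, IsTorusWeyl.toAlgHom_ainv, IsTorusWeyl.toAlgHom_K,
        IsTorusWeyl.toAlgHom_Kinv, IsTorusWeyl.toAlgHom_E, IsTorusWeyl.toAlgHom_F,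
        IsTorusWeyl.toAlgHom_b, IsTorusWeyl.toAlgHom_c, IsTorusWeyl.toAlgHom_e,
        IsTorusWeyl.toAlgHom_f, IsTorusWeyl.toAlgHom_y, IsTorusWeyl.toAlgHom_z,
        ← E_eq, ← F_eq, ← b_eq, ← c_eq])

theorem rotation_a : rotation k q (of k q .a) = of k q .K :=
  (isTorusWeyl k q).rotate.toAlgHom_a

theorem map_rotation_CA : (CA k q).map (rotation k q).toAlgHom = CK k q := by
  ext x
  rw [Subalgebra.mem_map, Subalgebra.mem_centralizer_iff]
  simp only [Set.mem_singleton_iff, forall_eq]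
  constructor
  · rintro ⟨t, ht, rfl⟩
    have := Subalgebra.mem_centralizer_iff k |>.1 ht _ rfl
    have := congrArg (rotation k q) this
    rwa [map_mul, map_mul, rotation_a] at this
  · intro hx
    refine ⟨(rotation k q).symm x, ?_, (rotation k q).apply_symm_apply x⟩
    rw [Subalgebra.mem_centralizer_iff]
    simp only [Set.mem_singleton_iff, forall_eq]
    apply (rotation k q).injective
    rw [map_mul, map_mul, rotation_a, AlgEquiv.apply_symm_apply, hx]

/-- The centralizers of `a` and of `K` are isomorphic. -/
theorem nonempty_CA_equiv_CK : Nonempty (CA k q ≃ₐ[k] CK k q) :=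
  ⟨((rotation k q).subalgebraMap (CA k q)).trans
    (Subalgebra.equivOfEq _ _ (map_rotation_CA k q))⟩

end Dq

end TorusWeyl

/-! ### Generic freeness for modules spanned by a monomial family -/

section GenericFreeness

open Finsupp

variable {R M σ : Type*} [CommRing R] [AddCommGroup M] [Module R M]
  (mo : MonomialOrder σ) (w : (σ →₀ ℕ) → M)

/-- The span of the vectors `w γ` with `γ` below `α` in the monomial order. -/
def lowerSpan (α : σ →₀ ℕ) : Submodule R M :=
  Submodule.span R (w '' {γ | mo.toSyn γ < mo.toSyn α})

/-- The ideal of all `r` such that `r • w α` lies in the span of the lower vectors. -/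
def leadIdeal (α : σ →₀ ℕ) : Ideal R :=
  (lowerSpan (R := R) mo w α).comap (LinearMap.toSpanSingleton R M (w α))

theorem mem_leadIdeal {α : σ →₀ ℕ} {r : R} :
    r ∈ leadIdeal mo w α ↔ r • w α ∈ lowerSpan (R := R) mo w α := Iff.rfl

theorem mem_lowerSpan {α γ : σ →₀ ℕ} (h : mo.toSyn γ < mo.toSyn α) :
    w γ ∈ lowerSpan (R := R) mo w α := Submodule.subset_span ⟨γ, h, rfl⟩

theorem lowerSpan_mono {α β : σ →₀ ℕ} (h : mo.toSyn α ≤ mo.toSyn β) :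
    lowerSpan (R := R) mo w α ≤ lowerSpan mo w β :=
  Submodule.span_mono (Set.image_mono fun _ hγ => lt_of_lt_of_le hγ h)

theorem lowerSpan_zero : lowerSpan (R := R) mo w 0 = ⊥ := by
  have : {γ | mo.toSyn γ < mo.toSyn 0} = (∅ : Set (σ →₀ ℕ)) := by
    ext γ
    simp only [map_zero, Set.mem_ofPred_eq, Set.mem_empty_iff_false, iff_false, not_lt]
    exact mo.zero_le _
  rw [lowerSpan, this, Set.image_empty, Submodule.span_empty]

variable {mo w}

/-- Applying `x i` to a relation expressing `r • w α` through lower vectors shifts every exponent by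
`single i 1`. Strict order is preserved by the shift, and the leading coefficient changes only by a
unit. -/
theorem leadIdeal_le_add_single {x : σ → M →ₗ[R] M}
    (hx : ∀ i α, ∃ u : Rˣ, x i (w α) - u • w (α + single i 1)
      ∈ lowerSpan (R := R) mo w (α + single i 1)) (i : σ) (α : σ →₀ ℕ) :
    leadIdeal (R := R) mo w α ≤ leadIdeal mo w (α + single i 1) := by
  have hlow : lowerSpan (R := R) mo w α ≤ (lowerSpan mo w (α + single i 1)).comap (x i) := by
    refine Submodule.span_le.2 ?_
    rintro _ ⟨γ, hγ, rfl⟩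
    obtain ⟨u, hu⟩ := hx i γ
    have hlt : mo.toSyn (γ + single i 1) < mo.toSyn (α + single i 1) := by
      rw [map_add, map_add]
      exact add_lt_add_left hγ _
    have h1 := lowerSpan_mono (R := R) mo w hlt.le hu
    have h2 := (lowerSpan (R := R) mo w (α + single i 1)).smul_mem (u : R)
      (mem_lowerSpan mo w hlt)
    have h3 := add_mem h1 h2
    rw [Units.smul_def, sub_add_cancel] at h3
    exact h3
  intro r hr
  obtain ⟨u, hu⟩ := hx i α
  have h1 : r • x i (w α) ∈ lowerSpan (R := R) mo w (α + single i 1) := by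
    rw [← map_smul]
    exact hlow hr
  have h2 := sub_mem h1 (Submodule.smul_mem _ r hu)
  rw [smul_sub, sub_sub_cancel, Units.smul_def, smul_comm] at h2
  have h3 := Submodule.smul_mem _ ((u⁻¹ : Rˣ) : R) h2
  rwa [smul_smul, Units.inv_mul, one_smul] at h3

theorem leadIdeal_mono {x : σ → M →ₗ[R] M}
    (hx : ∀ i α, ∃ u : Rˣ, x i (w α) - u • w (α + single i 1)
      ∈ lowerSpan (R := R) mo w (α + single i 1)) {α β : σ →₀ ℕ} (h : α ≤ β) :
    leadIdeal (R := R) mo w α ≤ leadIdeal mo w β := by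
  obtain ⟨δ, rfl⟩ := exists_add_of_le h
  clear h
  induction δ using Finsupp.induction_linear generalizing α with
  | zero => rw [add_zero]
  | add f g hf hg => exact hf.trans (by rw [← add_assoc]; exact hg)
  | single i n =>
    induction n with
    | zero => rw [single_zero, add_zero]
    | succ n ih =>
      rw [single_add, ← add_assoc]
      exact ih.trans (leadIdeal_le_add_single hx i _)

/-- Dickson's lemma: the minimal exponents with nonzero ideal form an antichain, hence are finite in
number. The product of one nonzero element from each of these ideals works, by monotonicity. -/
theorem exists_forall_mem_of_mono [IsDomain R] [Finite σ] {I : (σ →₀ ℕ) → Ideal R}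
    (hI : Monotone I) : ∃ f : R, f ≠ 0 ∧ ∀ α, I α ≠ ⊥ → f ∈ I α := by
  classical
  let S : Set (σ →₀ ℕ) := {α | I α ≠ ⊥}
  have hfin : {α | Minimal (· ∈ S) α}.Finite :=
    WellQuasiOrderedLE.finite_of_isAntichain (setOfPred_minimal_antichain _)
  have hex : ∀ α, ∃ r : R, r ≠ 0 ∧ (I α ≠ ⊥ → r ∈ I α) := fun α => by
    by_cases h : I α = ⊥
    · exact ⟨1, one_ne_zero, fun h' => absurd h h'⟩
    · obtain ⟨r, hr, hr0⟩ := Submodule.exists_mem_ne_zero_of_ne_bot h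
      exact ⟨r, hr0, fun _ => hr⟩
  choose r hr0 hr using hex
  refine ⟨∏ α ∈ hfin.toFinset, r α, Finset.prod_ne_zero_iff.2 fun α _ => hr0 α, fun α hα => ?_⟩
  obtain ⟨β, hβα, hβ⟩ := exists_minimal_le_of_wellFoundedLT (· ∈ S) α hα
  exact hI hβα ((I β).mem_of_dvd (Finset.dvd_prod_of_mem r (hfin.mem_toFinset.2 hβ)) (hr β hβ.prop))

/-- In a nontrivial relation the coefficient of the largest exponent would lie in a leading ideal
that is zero. -/
theorem linearIndependent_of_leadIdeal_eq_bot :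
    LinearIndependent R fun α : {α // leadIdeal (R := R) mo w α = ⊥} => w α := by
  classical
  rw [linearIndependent_iff]
  intro l hl
  by_contra hne
  obtain ⟨α, hα, hmax⟩ := l.support.exists_max_image (fun α => mo.toSyn α.1)
    (Finsupp.support_nonempty_iff.2 hne)
  rw [Finsupp.linearCombination_apply, Finsupp.sum, ← Finset.add_sum_erase _ _ hα] at hl
  have hmem : l α • w α ∈ lowerSpan (R := R) mo w α := by
    rw [eq_neg_of_add_eq_zero_left hl]
    refine neg_mem (sum_mem fun γ hγ => Submodule.smul_mem _ _ (mem_lowerSpan mo w ?_))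
    rw [Finset.mem_erase] at hγ
    exact lt_of_le_of_ne (hmax γ hγ.2) fun h => hγ.1 (Subtype.ext (mo.toSyn.injective h))
  have h0 : l α ∈ leadIdeal mo w α.1 := hmem
  rw [α.2, Submodule.mem_bot] at h0
  exact (Finsupp.mem_support_iff.1 hα) h0

/-- Well-founded induction on the monomial order: a vector with nonzero leading ideal is pushed into
the lower span by `f`. Each such reduction costs one factor `f`, which is why a power appears. -/
theorem exists_pow_smul_mem_span {f : R}
    (hf : ∀ α, leadIdeal (R := R) mo w α ≠ ⊥ → f ∈ leadIdeal mo w α)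
    (hspan : Submodule.span R (Set.range w) = ⊤) (m : M) :
    ∃ n : ℕ, f ^ n • m ∈ Submodule.span R
      (Set.range fun α : {α // leadIdeal (R := R) mo w α = ⊥} => w α) := by
  set N := Submodule.span R
      (Set.range fun α : {α // leadIdeal (R := R) mo w α = ⊥} => w α)
  let T : Submodule R M :=
    { carrier := {m | ∃ n : ℕ, f ^ n • m ∈ N}
      zero_mem' := ⟨0, by simp⟩
      add_mem' := by
        rintro a b ⟨n, hn⟩ ⟨m, hm⟩
        refine ⟨n + m, ?_⟩
        rw [smul_add]
        refine add_mem ?_ ?_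
        · rw [add_comm, pow_add, mul_smul]; exact N.smul_mem _ hn
        · rw [pow_add, mul_smul]; exact N.smul_mem _ hm
      smul_mem' := by
        rintro r a ⟨n, hn⟩
        exact ⟨n, by rw [smul_comm]; exact N.smul_mem _ hn⟩ }
  have hw : ∀ s : mo.syn, ∀ α, mo.toSyn α = s → w α ∈ T := fun s => by
    induction s using WellFoundedLT.induction with
    | ind s ih =>
      rintro α rfl
      by_cases h : leadIdeal (R := R) mo w α = ⊥
      · exact ⟨0, by rw [pow_zero, one_smul]; exact Submodule.subset_span ⟨⟨α, h⟩, rfl⟩⟩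
      · have hlow : lowerSpan (R := R) mo w α ≤ T := by
          refine Submodule.span_le.2 ?_
          rintro _ ⟨γ, hγ, rfl⟩
          exact ih _ hγ γ rfl
        obtain ⟨n, hn⟩ := hlow (hf α h)
        exact ⟨n + 1, by rw [pow_succ, mul_smul]; exact hn⟩
  have : (⊤ : Submodule R M) ≤ T := by
    rw [← hspan, Submodule.span_le]
    rintro _ ⟨α, rfl⟩
    exact hw _ α rfl
  exact this Submodule.mem_top

/-- A generic freeness statement: a divisible module over a domain with enough primes which is
spanned by a family that behaves like monomials in finitely many variables has torsion. -/
theorem exists_smul_eq_zero_of_monomial_family [IsDomain R] [Finite σ] {x : σ → M →ₗ[R] M}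
    (hx : ∀ i α, ∃ u : Rˣ, x i (w α) - u • w (α + single i 1)
      ∈ lowerSpan (R := R) mo w (α + single i 1))
    (hspan : Submodule.span R (Set.range w) = ⊤)
    (hsurj : ∀ g : R, g ≠ 0 → ∃ m : M, g • m = w 0)
    (hR : ∀ f : R, f ≠ 0 → ∃ g : R, g ≠ 0 ∧ ∀ n : ℕ, ¬ g ∣ f ^ n) :
    ∃ r : R, r ≠ 0 ∧ r • w 0 = 0 := by
  by_contra! hcon
  have h0 : leadIdeal (R := R) mo w 0 = ⊥ := by
    refine (Submodule.eq_bot_iff _).2 fun r hr => ?_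
    rw [mem_leadIdeal, lowerSpan_zero, Submodule.mem_bot] at hr
    by_contra hr0
    exact hcon r hr0 hr
  obtain ⟨f, hf0, hf⟩ := exists_forall_mem_of_mono (I := leadIdeal (R := R) mo w)
    fun _ _ h => leadIdeal_mono hx h
  obtain ⟨g, hg0, hg⟩ := hR f hf0
  obtain ⟨m, hm⟩ := hsurj g hg0
  obtain ⟨n, hn⟩ := exists_pow_smul_mem_span hf hspan m
  obtain ⟨c, hc⟩ := (Finsupp.mem_span_range_iff_exists_finsupp).1 hn
  have hli := linearIndependent_of_leadIdeal_eq_bot (R := R) (mo := mo) (w := w)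
  -- Since `f ^ n • m = ∑ c α • w α` and `g • m = w 0`, the vector `f ^ n • w 0` has two expansions
  -- in an independent family. Comparing the coefficients at exponent 0 gives `g ∣ f ^ n`.
  have key : Finsupp.single ⟨0, h0⟩ (f ^ n) = g • c := by
    refine hli ?_
    rw [Finsupp.linearCombination_single, map_smul, Finsupp.linearCombination_apply, hc,
      smul_comm, hm]
  have := DFunLike.congr_fun key ⟨0, h0⟩
  rw [Finsupp.single_eq_same, Finsupp.smul_apply, smul_eq_mul] at this
  exact hg n ⟨_, this⟩

end GenericFreeness

/-! ### The grading of `D_q` by conjugation with `a`, and generators of `C(a, D_q)` -/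

section Grading

/-- Splitting `x ∈ V i` along the `W j` leaves a remainder that lies both in `V i` and in the span
of the other `V j`, hence vanishes. This identifies the graded pieces of `D_q` and the weight spaces
of induced modules from mere inclusions. -/
theorem iSupIndep_eq_of_le {R M ι : Type*} [Ring R] [AddCommGroup M] [Module R M]
    {V W : ι → Submodule R M} (hV : iSupIndep V) (hWV : ∀ i, W i ≤ V i) (hW : ⨆ i, W i = ⊤)
    (i : ι) : W i = V i := by
  refine le_antisymm (hWV i) fun x hx => ?_
  have hx' : x ∈ W i ⊔ ⨆ (j) (_ : j ≠ i), W j := by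
    have : (⊤ : Submodule R M) ≤ W i ⊔ ⨆ (j) (_ : j ≠ i), W j := by
      rw [← hW]
      refine iSup_le fun j => ?_
      by_cases h : j = i
      · subst h; exact le_sup_left
      · exact le_sup_of_le_right (le_iSup₂_of_le j h le_rfl)
    exact this Submodule.mem_top
  obtain ⟨w, hw, r, hr, rfl⟩ := Submodule.mem_sup.1 hx'
  have hr' : r ∈ ⨆ (j) (_ : j ≠ i), V j := (iSup₂_mono fun j _ => hWV j) hr
  have hr'' : r ∈ V i := by
    have := sub_mem hx (hWV i hw)
    rwa [add_sub_cancel_left] at this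
  rw [Submodule.disjoint_def.1 (hV i) r hr'' hr', add_zero]
  exact hw

theorem zpow_injective_of_not_root {k : Type*} [Field k] {q : kˣ}
    (hq : ∀ n : ℕ, 0 < n → q ^ n ≠ 1) : Function.Injective fun i : ℤ => q ^ i :=
  injective_zpow_iff_not_isOfFinOrder.2 fun h => by
    obtain ⟨n, hn, hqn⟩ := isOfFinOrder_iff_pow_eq_one.1 h
    exact hq n hn hqn

variable (k : Type u) [Field k] (q : kˣ)

namespace Dq

/-- Conjugation by `a`, as a linear endomorphism of `D_q`. -/
def conjA : Module.End k (Dq k q) :=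
  LinearMap.mulLeft k (of k q .a) ∘ₗ LinearMap.mulRight k (of k q .ainv)

/-- The homogeneous component of degree `i`: all `x` with `a x a⁻¹ = qⁱ x`. -/
def gr (i : ℤ) : Submodule k (Dq k q) := (conjA k q).eigenspace ((q ^ i : kˣ) : k)

variable {k q}

theorem mem_gr {i : ℤ} {x : Dq k q} :
    x ∈ gr k q i ↔ of k q .a * x = ((q ^ i : kˣ) : k) • (x * of k q .a) := by
  rw [gr, Module.End.mem_eigenspace_iff]
  change of k q .a * (x * of k q .ainv) = _ ↔ _
  constructor
  · intro h
    calc of k q .a * x = of k q .a * (x * of k q .ainv) * of k q .a := by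
          rw [mul_assoc, mul_assoc, ainv_a, mul_one]
      _ = _ := by rw [h, smul_mul_assoc]
  · intro h
    rw [← mul_assoc, h, smul_mul_assoc, mul_assoc, a_ainv, mul_one]

theorem mem_CA {x : Dq k q} : x ∈ CA k q ↔ of k q .a * x = x * of k q .a := by
  rw [Subalgebra.mem_centralizer_iff]
  simp

theorem mem_gr_zero {x : Dq k q} : x ∈ gr k q 0 ↔ x ∈ CA k q := by
  rw [mem_gr, mem_CA, zpow_zero, Units.val_one, one_smul]

theorem mul_mem_gr {i j : ℤ} {x y : Dq k q} (hx : x ∈ gr k q i) (hy : y ∈ gr k q j) :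
    x * y ∈ gr k q (i + j) := by
  rw [mem_gr] at *
  rw [← mul_assoc, hx, smul_mul_assoc, mul_assoc, hy, mul_smul_comm, smul_smul, zpow_add,
    Units.val_mul, mul_assoc]

variable (k q)

/-- The unit `K` of `D_q`. -/
def Kunit : (Dq k q)ˣ := ⟨of k q .K, of k q .Kinv, K_mul_Kinv k q, Kinv_mul_K k q⟩

theorem K_mem_gr : of k q .K ∈ gr k q 1 := by
  rw [mem_gr, zpow_one, a_K]

theorem Kinv_mem_gr : of k q .Kinv ∈ gr k q (-1) := by
  rw [mem_gr, (isTorusWeyl k q).aK', zpow_neg_one, Units.val_inv_eq_inv_val]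

theorem Kunit_zpow_mem_gr (j : ℤ) : ((Kunit k q ^ j : (Dq k q)ˣ) : Dq k q) ∈ gr k q j := by
  induction j with
  | zero => rw [zpow_zero, Units.val_one, mem_gr_zero]; exact one_mem _
  | succ n ih =>
    rw [zpow_add_one, Units.val_mul]
    exact mul_mem_gr ih (K_mem_gr k q)
  | pred n ih =>
    rw [zpow_sub_one, Units.val_mul]
    exact mul_mem_gr ih (Kinv_mem_gr k q)

/-- The subalgebra generated by `a`, `a⁻¹`, `E a²`, `c K⁻¹ a⁻¹`, `b K⁻¹ a` and `F K a⁻²`. -/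
def torusCentralizer : Subalgebra k (Dq k q) :=
  Algebra.adjoin k {of k q .a, of k q .ainv, e k q, y k q, z k q, f k q}

theorem torusCentralizer_le_CA : torusCentralizer k q ≤ CA k q := by
  have h := isTorusWeyl k q
  refine Algebra.adjoin_le ?_
  rintro x (rfl | rfl | rfl | rfl | rfl | rfl) <;> refine mem_CA.2 ?_
  · rfl
  · rw [a_ainv, ainv_a]
  · exact h.ae
  · exact h.ay
  · exact h.az
  · exact h.af

variable {k q} in
theorem conj_mem_of_forall {u u' : Dq k q} (h1 : u' * u = 1) (h2 : u * u' = 1)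
    (h : ∀ x ∈ ({of k q .a, of k q .ainv, e k q, y k q, z k q, f k q} : Set (Dq k q)),
      ∃ s : k, u * x = s • (x * u)) {t : Dq k q} (ht : t ∈ torusCentralizer k q) :
    u * t * u' ∈ torusCentralizer k q := by
  induction ht using Algebra.adjoin_induction with
  | mem x hx =>
    obtain ⟨s, hs⟩ := h x hx
    rw [hs, smul_mul_assoc, mul_assoc, h2, mul_one]
    exact Subalgebra.smul_mem _ (Algebra.subset_adjoin hx) s
  | algebraMap r =>
    rw [← Algebra.commutes, mul_assoc, h2, mul_one]
    exact Subalgebra.algebraMap_mem _ r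
  | add x y _ _ hx hy => rw [mul_add, add_mul]; exact add_mem hx hy
  | mul x y _ _ hx hy =>
    have : u * (x * y) * u' = (u * x * u') * (u * y * u') := by
      calc u * (x * y) * u' = u * x * 1 * y * u' := by noncomm_ring
        _ = u * x * (u' * u) * y * u' := by rw [h1]
        _ = _ := by noncomm_ring
    rw [this]
    exact mul_mem hx hy

theorem Kunit_zpow_conj_mem (j : ℤ) {t : Dq k q} (ht : t ∈ torusCentralizer k q) :
    ((Kunit k q ^ j : (Dq k q)ˣ) : Dq k q) * t * ((Kunit k q ^ (-j) : (Dq k q)ˣ) : Dq k q)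
      ∈ torusCentralizer k q := by
  have h := isTorusWeyl k q
  have hK : ∀ x ∈ ({of k q .a, of k q .ainv, e k q, y k q, z k q, f k q} : Set (Dq k q)),
      ∃ s : k, of k q .K * x = s • (x * of k q .K) := by
    rintro x (rfl | rfl | rfl | rfl | rfl | rfl)
    · exact ⟨_, K_mul_a k q⟩
    · exact ⟨_, h.Ka'⟩
    · exact ⟨1, by rw [one_smul, h.Ke]⟩
    · exact ⟨1, by rw [one_smul, h.Ky]⟩
    · exact ⟨1, by rw [one_smul, h.Kz]⟩
    · exact ⟨1, by rw [one_smul, h.Kf]⟩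
  have hK' : ∀ x ∈ ({of k q .a, of k q .ainv, e k q, y k q, z k q, f k q} : Set (Dq k q)),
      ∃ s : k, of k q .Kinv * x = s • (x * of k q .Kinv) := by
    rintro x (rfl | rfl | rfl | rfl | rfl | rfl)
    · exact ⟨_, h.K'a⟩
    · exact ⟨_, h.rotate.a'K⟩
    · exact ⟨1, by rw [one_smul, h.K'e]⟩
    · exact ⟨1, by rw [one_smul, h.K'y]⟩
    · exact ⟨1, by rw [one_smul, h.K'z]⟩
    · exact ⟨1, by rw [one_smul, h.K'f]⟩
  induction j with
  | zero => simpa using ht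
  | succ n ih =>
    have := conj_mem_of_forall (Kinv_mul_K k q) (K_mul_Kinv k q) hK ih
    have e1 : Kunit k q ^ (n + 1 : ℤ) = Kunit k q * Kunit k q ^ (n : ℤ) := by
      rw [add_comm, zpow_add, zpow_one]
    have e2 : Kunit k q ^ (-(n + 1) : ℤ) = Kunit k q ^ (-n : ℤ) * (Kunit k q)⁻¹ := by
      rw [neg_add, zpow_add, zpow_neg_one]
    rw [e1, e2, Units.val_mul, Units.val_mul]
    simp only [mul_assoc] at this ⊢
    exact this
  | pred n ih =>
    have := conj_mem_of_forall (K_mul_Kinv k q) (Kinv_mul_K k q) hK' ih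
    have e1 : Kunit k q ^ (-n - 1 : ℤ) = (Kunit k q)⁻¹ * Kunit k q ^ (-n : ℤ) := by
      rw [sub_eq_add_neg, add_comm, zpow_add, zpow_neg_one]
    have e2 : Kunit k q ^ (-(-n - 1) : ℤ) = Kunit k q ^ (- -n : ℤ) * Kunit k q := by
      rw [neg_sub, sub_eq_add_neg, add_comm, zpow_add, zpow_one]
    rw [e1, e2, Units.val_mul, Units.val_mul]
    simp only [mul_assoc] at this ⊢
    exact this

/-- The space `torusCentralizer · Kʲ`. -/
def torusGr (j : ℤ) : Submodule k (Dq k q) :=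
  (Subalgebra.toSubmodule (torusCentralizer k q)).comap
    (LinearMap.mulRight k ((Kunit k q ^ (-j) : (Dq k q)ˣ) : Dq k q))

variable {k q} in
theorem mem_torusGr {j : ℤ} {x : Dq k q} :
    x ∈ torusGr k q j ↔
      x * ((Kunit k q ^ (-j) : (Dq k q)ˣ) : Dq k q) ∈ torusCentralizer k q := Iff.rfl

theorem torusGr_le_gr (j : ℤ) : torusGr k q j ≤ gr k q j := fun x hx => by
  have h1 := mem_gr_zero.2 (torusCentralizer_le_CA k q (mem_torusGr.1 hx))
  have := mul_mem_gr h1 (Kunit_zpow_mem_gr k q j)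
  rwa [mul_assoc, ← Units.val_mul, ← zpow_add, neg_add_cancel, zpow_zero, Units.val_one, mul_one,
    zero_add] at this

variable {k q} in
theorem mul_mem_torusGr {i j : ℤ} {x y : Dq k q} (hx : x ∈ torusGr k q i)
    (hy : y ∈ torusGr k q j) : x * y ∈ torusGr k q (i + j) := by
  rw [mem_torusGr] at *
  -- `x y K⁻ⁱ⁻ʲ = (x K⁻ⁱ) · Kⁱ (y K⁻ʲ) K⁻ⁱ`.
  have := mul_mem hx (Kunit_zpow_conj_mem k q i hy)
  convert this using 1
  have e1 : Kunit k q ^ (-(i + j)) = Kunit k q ^ (-j) * Kunit k q ^ (-i) := by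
    rw [← zpow_add]; congr 1; ring
  have e2 : ((Kunit k q ^ (-i) : (Dq k q)ˣ) : Dq k q) * ((Kunit k q ^ i : (Dq k q)ˣ) : Dq k q)
      = 1 := by
    rw [← Units.val_mul, ← zpow_add, neg_add_cancel, zpow_zero, Units.val_one]
  rw [e1, Units.val_mul]
  simp only [mul_assoc, cancel_mul e2]

theorem torusCentralizer_le_torusGr {x : Dq k q} (hx : x ∈ torusCentralizer k q) :
    x ∈ torusGr k q 0 := by
  rw [mem_torusGr, neg_zero, zpow_zero, Units.val_one, mul_one]
  exact hx

/-- The sum of all these pieces is closed under multiplication and contains `a`, `e`, `y`, `z`, `f`,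
`K` and the inverses, from which every generator of `D_q` is recovered. -/
theorem iSup_torusGr : ⨆ j, torusGr k q j = ⊤ := by
  let T : Subalgebra k (Dq k q) :=
    { carrier := (⨆ j, torusGr k q j : Submodule k (Dq k q))
      mul_mem' := by
        intro x y hx hy
        refine Submodule.iSup_induction _ (motive := fun x => x * y ∈ ⨆ j, torusGr k q j) hx
          (fun i x hx => ?_) (by rw [zero_mul]; exact zero_mem _)
          (fun x x' h h' => by rw [add_mul]; exact add_mem h h')
        refine Submodule.iSup_induction _ (motive := fun y => x * y ∈ ⨆ j, torusGr k q j) hy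
          (fun j y hy => Submodule.mem_iSup_of_mem _ (mul_mem_torusGr hx hy))
          (by rw [mul_zero]; exact zero_mem _)
          (fun y y' h h' => by rw [mul_add]; exact add_mem h h')
      add_mem' := fun hx hy => add_mem hx hy
      algebraMap_mem' := fun r => Submodule.mem_iSup_of_mem 0
        (torusCentralizer_le_torusGr k q (Subalgebra.algebraMap_mem _ r)) }
  have hT0 : ∀ {x}, x ∈ ({of k q .a, of k q .ainv, e k q, y k q, z k q, f k q} : Set (Dq k q)) →
      x ∈ T := fun hx => Submodule.mem_iSup_of_mem 0
        (torusCentralizer_le_torusGr k q (Algebra.subset_adjoin hx))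
  have ha : of k q .a ∈ T := hT0 (by simp)
  have ha' : of k q .ainv ∈ T := hT0 (by simp)
  have he : e k q ∈ T := hT0 (by simp)
  have hy : y k q ∈ T := hT0 (by simp)
  have hz : z k q ∈ T := hT0 (by simp)
  have hf : f k q ∈ T := hT0 (by simp)
  have hK : of k q .K ∈ T := Submodule.mem_iSup_of_mem 1 (by
    rw [mem_torusGr, zpow_neg_one]
    change of k q .K * of k q .Kinv ∈ _
    rw [K_mul_Kinv]; exact one_mem _)
  have hK' : of k q .Kinv ∈ T := Submodule.mem_iSup_of_mem (-1) (by
    rw [mem_torusGr, neg_neg, zpow_one]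
    change of k q .Kinv * of k q .K ∈ _
    rw [Kinv_mul_K]; exact one_mem _)
  have hT : T = ⊤ := by
    rw [← top_le_iff, ← adjoin_range_of k q]
    refine Algebra.adjoin_le ?_
    rintro _ ⟨x, rfl⟩
    cases x
    · exact ha
    · exact ha'
    · rw [b_eq]; exact mul_mem (mul_mem hz ha') hK
    · rw [c_eq]; exact mul_mem (mul_mem hy ha) hK
    · exact hK
    · exact hK'
    · rw [E_eq]; exact mul_mem he (pow_mem ha' 2)
    · rw [F_eq]; exact mul_mem (mul_mem hf (pow_mem ha 2)) hK'
  refine (Submodule.eq_top_iff').2 fun x => ?_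
  have : x ∈ T := by rw [hT]; exact Algebra.mem_top
  exact this

theorem iSup_gr : ⨆ j, gr k q j = ⊤ := by
  rw [← top_le_iff, ← iSup_torusGr k q]
  exact iSup_mono (torusGr_le_gr k q)

variable {k q}

/-- Here the hypothesis on `q` enters: distinct degrees correspond to distinct eigenvalues of
conjugation by `a`. -/
theorem iSupIndep_gr (hq : ∀ n : ℕ, 0 < n → q ^ n ≠ 1) : iSupIndep (gr k q) :=
  (Module.End.eigenspaces_iSupIndep (conjA k q)).comp
    (Units.val_injective.comp (zpow_injective_of_not_root hq))

theorem CA_eq_torusCentralizer (hq : ∀ n : ℕ, 0 < n → q ^ n ≠ 1) :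
    CA k q = torusCentralizer k q := by
  refine le_antisymm (fun x hx => ?_) (torusCentralizer_le_CA k q)
  rw [← mem_gr_zero, ← iSupIndep_eq_of_le (iSupIndep_gr hq) (torusGr_le_gr k q)
    (iSup_torusGr k q), mem_torusGr, neg_zero, zpow_zero, Units.val_one, mul_one] at hx
  exact hx

theorem isCompl_gr_zero (hq : ∀ n : ℕ, 0 < n → q ^ n ≠ 1) :
    IsCompl (gr k q 0) (⨆ (j) (_ : j ≠ 0), gr k q j) := by
  refine ⟨iSupIndep_gr hq 0, codisjoint_iff.2 (top_le_iff.1 ?_)⟩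
  rw [← iSup_gr k q]
  refine iSup_le fun j => ?_
  by_cases h : j = 0
  · subst h; exact le_sup_left
  · exact le_sup_of_le_right (le_iSup₂_of_le j h le_rfl)

/-- Every element of `D_q` is the sum of an element of `C(a, D_q)` and of homogeneous elements of
nonzero degree. -/
theorem exists_add_of_gr (hq : ∀ n : ℕ, 0 < n → q ^ n ≠ 1) (d : Dq k q) :
    ∃ t ∈ CA k q, ∃ r ∈ (⨆ (j) (_ : j ≠ 0), gr k q j : Submodule k (Dq k q)), d = t + r := by
  have : d ∈ gr k q 0 ⊔ ⨆ (j) (_ : j ≠ 0), gr k q j := by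
    rw [(isCompl_gr_zero hq).sup_eq_top]; exact Submodule.mem_top
  obtain ⟨t, ht, r, hr, rfl⟩ := Submodule.mem_sup.1 this
  exact ⟨t, mem_gr_zero.1 ht, r, hr, rfl⟩

/-- The projection of `D_q` onto its component of degree zero. -/
noncomputable def proj (hq : ∀ n : ℕ, 0 < n → q ^ n ≠ 1) (d : Dq k q) : CA k q :=
  ⟨(gr k q 0).projectionOnto _ (isCompl_gr_zero hq) d, mem_gr_zero.1 (Subtype.prop _)⟩

theorem proj_add (hq : ∀ n : ℕ, 0 < n → q ^ n ≠ 1) (d d' : Dq k q) :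
    proj hq (d + d') = proj hq d + proj hq d' :=
  Subtype.ext (by simp [proj])

theorem proj_of_mem (hq : ∀ n : ℕ, 0 < n → q ^ n ≠ 1) (t : CA k q) : proj hq t = t :=
  Subtype.ext (congrArg (Subtype.val (p := (· ∈ gr k q 0)))
    ((gr k q 0).projectionOnto_apply_left (isCompl_gr_zero hq) ⟨t, mem_gr_zero.2 t.2⟩))

theorem proj_eq_zero (hq : ∀ n : ℕ, 0 < n → q ^ n ≠ 1) {r : Dq k q}
    (hr : r ∈ (⨆ (j) (_ : j ≠ 0), gr k q j : Submodule k (Dq k q))) : proj hq r = 0 :=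
  Subtype.ext (congrArg (Subtype.val (p := (· ∈ gr k q 0)))
    ((gr k q 0).projectionOnto_apply_right (isCompl_gr_zero hq) ⟨r, hr⟩))

/-- Right multiplication by an element of degree zero preserves every degree. This linearity makes
`d ⊗ m ↦ proj d • m` compatible with the balancing relations. -/
theorem proj_mul (hq : ∀ n : ℕ, 0 < n → q ^ n ≠ 1) (d : Dq k q) (s : CA k q) :
    proj hq (d * s) = proj hq d * s := by
  obtain ⟨t, ht, r, hr, rfl⟩ := exists_add_of_gr hq d
  have hrs : r * s ∈ (⨆ (j) (_ : j ≠ 0), gr k q j : Submodule k (Dq k q)) := by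
    have : (⨆ (j) (_ : j ≠ 0), gr k q j : Submodule k (Dq k q)) ≤
        (⨆ (j) (_ : j ≠ 0), gr k q j : Submodule k (Dq k q)).comap
          (LinearMap.mulRight k (s : Dq k q)) := by
      refine iSup₂_le fun j hj x hx => ?_
      have := mul_mem_gr hx (mem_gr_zero.2 s.2)
      rw [add_zero] at this
      exact Submodule.mem_iSup_of_mem j (Submodule.mem_iSup_of_mem hj this)
    exact this hr
  rw [add_mul, proj_add, proj_add, proj_eq_zero hq hrs, proj_eq_zero hq hr, add_zero, add_zero]
  have h1 := proj_of_mem hq (⟨t, ht⟩ * s)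
  have h2 := proj_of_mem hq ⟨t, ht⟩
  exact h1.trans (congrArg (· * s) h2.symm)

end Dq

end Grading

/-! ### The central element `a` acts by a scalar on simple `C(a, D_q)`-modules -/

section CentralCharacter

open Finsupp

variable {k A : Type*} [Field k] [Ring A] [Algebra k A]

theorem mul_pow_of_smul_comm {x p : A} {s : k} (h : x * p = s • (p * x)) (n : ℕ) :
    x * p ^ n = s ^ n • (p ^ n * x) := by
  induction n with
  | zero => simp
  | succ n ih =>
    rw [pow_succ p, ← mul_assoc, ih, smul_mul_assoc, mul_assoc, h, mul_smul_comm, smul_smul,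
      ← mul_assoc, ← pow_succ]

theorem exists_mul_pow_of_weyl {x p : A} {s t : k} (h : x * p = s • (p * x) + t • 1) (n : ℕ) :
    ∃ t' : k, x * p ^ n = s ^ n • (p ^ n * x) + t' • p ^ (n - 1) := by
  induction n with
  | zero => exact ⟨0, by simp⟩
  | succ n ih =>
    obtain ⟨t', ih⟩ := ih
    refine ⟨s ^ n * t + t', ?_⟩
    -- At `n = 0` the truncated exponent would break this identity, but there the induction
    -- hypothesis forces `t' • 1 = 0`.
    have hp : t' • p ^ (n - 1) * p = t' • p ^ n := by
      cases n with
      | zero =>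
        have h0 : t' • (1 : A) = 0 := by simpa using ih
        simp [h0]
      | succ n => rw [smul_mul_assoc, Nat.add_sub_cancel, ← pow_succ]
    rw [pow_succ p, ← mul_assoc, ih, add_mul, hp, smul_mul_assoc, mul_assoc, h, mul_add,
      mul_smul_comm, mul_smul_comm, mul_one, smul_add, smul_smul, smul_smul, ← mul_assoc,
      ← pow_succ, ← pow_succ, add_smul, Nat.add_sub_cancel, add_assoc]

/-- Elements `a', e, y, z, f` of an algebra, with `a'` commuting with the others, which can be
reordered up to nonzero scalars and lower terms. -/
structure IsReorderable (k : Type*) {A : Type*} [Field k] [Ring A] [Algebra k A]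
    (a' e y z f : A) : Prop where
  ea' : e * a' = a' * e
  ya' : y * a' = a' * y
  za' : z * a' = a' * z
  fa' : f * a' = a' * f
  ye : ∃ s t : k, s ≠ 0 ∧ y * e = s • (e * y) + t • 1
  ze : ∃ s : k, s ≠ 0 ∧ z * e = s • (e * z)
  fe : ∃ s : k, s ≠ 0 ∧ f * e = s • (e * f)
  zy : ∃ s : k, s ≠ 0 ∧ z * y = s • (y * z)
  fy : ∃ s : k, s ≠ 0 ∧ f * y = s • (y * f)
  fz : ∃ s t : k, s ≠ 0 ∧ f * z = s • (z * f) + t • 1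

namespace IsReorderable

variable {a' e y z f : A}

/-- The ordered monomial with exponents `α`. -/
def mono (a' e y z f : A) (α : Fin 5 →₀ ℕ) : A :=
  a' ^ α 0 * (e ^ α 1 * (y ^ α 2 * (z ^ α 3 * f ^ α 4)))

variable (h : IsReorderable k a' e y z f)

include h

/-- The `i`-th letter is carried past the earlier ones to its place, picking up nonzero scalars.
Only `y` crossing `e` and `f` crossing `z` leave an extra term, in which the crossed exponent drops
by one. -/
theorem exists_mul_mono (i : Fin 5) (α : Fin 5 →₀ ℕ) :
    ∃ s t : k, ∃ γ < α + single i 1, s ≠ 0 ∧ ![a', e, y, z, f] i * mono a' e y z f α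
      = s • mono a' e y z f (α + single i 1) + t • mono a' e y z f γ := by
  have hlt : α < α + single i 1 := by
    refine lt_of_le_of_ne (self_le_add_right _ _) fun h => ?_
    have := DFunLike.congr_fun h i
    simp at this
  -- The subtraction is truncated; when `α j = 0` the exponent stays `α`, which is still strictly
  -- below.
  have hlt' : ∀ j, α - single j 1 < α + single i 1 := fun j => lt_of_le_of_lt tsub_le_self hlt
  have comm : ∀ {x : A} (_ : x * a' = a' * x) (n : ℕ) (w : A),
      x * (a' ^ n * w) = a' ^ n * (x * w) := fun hx n w => by
    have := (Commute.pow_right (show Commute _ a' from hx) n).eq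
    rw [← mul_assoc, this, mul_assoc]
  have scal : ∀ {x p : A} {s : k} (_ : x * p = s • (p * x)) (n : ℕ) (w : A),
      x * (p ^ n * w) = s ^ n • (p ^ n * (x * w)) := fun hx n w =>
    smul_comm_mul (mul_pow_of_smul_comm hx n) w
  fin_cases i
  · refine ⟨1, 0, _, hlt, one_ne_zero, ?_⟩
    simp [mono, pow_succ', mul_assoc]
  · refine ⟨1, 0, _, hlt, one_ne_zero, ?_⟩
    simp [mono, pow_succ', mul_assoc, comm h.ea']
  · obtain ⟨s, t, hs, hye⟩ := h.ye
    obtain ⟨t', ht'⟩ := exists_mul_pow_of_weyl hye (α 1)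
    refine ⟨s ^ α 1, t', _, hlt' 1, pow_ne_zero _ hs, ?_⟩
    have : y * (e ^ α 1 * (y ^ α 2 * (z ^ α 3 * f ^ α 4)))
        = s ^ α 1 • (e ^ α 1 * (y ^ (α 2 + 1) * (z ^ α 3 * f ^ α 4)))
          + t' • (e ^ (α 1 - 1) * (y ^ α 2 * (z ^ α 3 * f ^ α 4))) := by
      rw [← mul_assoc, ht', add_mul, smul_mul_assoc, smul_mul_assoc, mul_assoc (e ^ α 1),
        ← mul_assoc y, ← pow_succ']
    simp [mono, comm h.ya', this, mul_add]
  · obtain ⟨s, hs, hze⟩ := h.ze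
    obtain ⟨s', hs', hzy⟩ := h.zy
    refine ⟨s ^ α 1 * s' ^ α 2, 0, _, hlt, mul_ne_zero (pow_ne_zero _ hs) (pow_ne_zero _ hs'), ?_⟩
    simp [mono, comm h.za', scal hze, scal hzy, smul_smul, pow_succ', mul_assoc]
  · obtain ⟨s, hs, hfe⟩ := h.fe
    obtain ⟨s', hs', hfy⟩ := h.fy
    obtain ⟨r, t, hr, hfz⟩ := h.fz
    obtain ⟨t', ht'⟩ := exists_mul_pow_of_weyl hfz (α 3)
    refine ⟨s ^ α 1 * s' ^ α 2 * r ^ α 3, s ^ α 1 * s' ^ α 2 * t', _, hlt' 3,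
      mul_ne_zero (mul_ne_zero (pow_ne_zero _ hs) (pow_ne_zero _ hs')) (pow_ne_zero _ hr), ?_⟩
    have : f * (z ^ α 3 * f ^ α 4)
        = r ^ α 3 • (z ^ α 3 * f ^ (α 4 + 1)) + t' • (z ^ (α 3 - 1) * f ^ α 4) := by
      rw [← mul_assoc, ht', add_mul, smul_mul_assoc, smul_mul_assoc, mul_assoc (z ^ α 3),
        ← pow_succ']
    simp [mono, comm h.fa', scal hfe, scal hfy, this, mul_add, smul_smul, mul_assoc]

open Polynomial in
/-- If an algebra is generated by reorderable elements together with a central element `a`, then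
on every simple module some nonzero polynomial in `a` has a nonzero kernel. -/
theorem exists_aeval_smul_eq_zero [Infinite k] {a : A} (ha : ∀ t : A, t * a = a * t)
    (hgen : Algebra.adjoin k {a, a', e, y, z, f} = ⊤)
    {M : Type*} [AddCommGroup M] [Module A M] [IsSimpleModule A M] {v : M} (hv : v ≠ 0) :
    ∃ r : k[X], r ≠ 0 ∧ aeval a r • v = 0 := by
  by_contra! hcon
  have hcen : ∀ (p : k[X]) (t : A), t * aeval a p = aeval a p * t := fun p t => by
    have : aeval a p ∈ Subalgebra.centralizer k {t} := by
      refine Algebra.adjoin_le (Set.singleton_subset_iff.2 ?_) (aeval_mem_adjoin_singleton k a)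
      rw [SetLike.mem_coe, Subalgebra.mem_centralizer_iff]
      rintro _ rfl
      exact ha _
    exact (Subalgebra.mem_centralizer_iff k).1 this t rfl
  let : Module k[X] M := Module.compHom M (aeval a : k[X] →ₐ[k] A).toRingHom
  have hsmul : ∀ (p : k[X]) (m : M), p • m = aeval a p • m := fun _ _ => rfl
  have hC : ∀ (s : k) (t : A) (m : M), (s • t) • m = (Polynomial.C s : k[X]) • t • m :=
    fun s t m => by rw [hsmul, aeval_C, smul_smul, Algebra.smul_def]
  let x : Fin 5 → M →ₗ[k[X]] M := fun i =>
    { toFun := fun m => ![a', e, y, z, f] i • m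
      map_add' := fun m m' => smul_add _ m m'
      map_smul' := fun p m => by
        rw [RingHom.id_apply, hsmul, hsmul, smul_smul, smul_smul, hcen] }
  let w : (Fin 5 →₀ ℕ) → M := fun α => mono a' e y z f α • v
  have hw0 : w 0 = v := by simp [w, mono]
  let mo : MonomialOrder (Fin 5) := MonomialOrder.lex
  have hxw : ∀ i α, ∃ s t : k, ∃ γ < α + single i 1, s ≠ 0 ∧
      x i (w α) = (Polynomial.C s : k[X]) • w (α + single i 1) + (Polynomial.C t : k[X]) • w γ := by
    intro i α
    obtain ⟨s, t, γ, hγ, hs, heq⟩ := h.exists_mul_mono i α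
    refine ⟨s, t, γ, hγ, hs, ?_⟩
    change ![a', e, y, z, f] i • mono a' e y z f α • v = _
    rw [smul_smul, heq, add_smul, hC, hC]
  have hx : ∀ i α, ∃ u : k[X]ˣ, x i (w α) - u • w (α + single i 1)
      ∈ lowerSpan (R := k[X]) mo w (α + single i 1) := fun i α => by
    obtain ⟨s, t, γ, hγ, hs, heq⟩ := hxw i α
    refine ⟨Units.map (Polynomial.C : k →+* k[X]).toMonoidHom (Units.mk0 s hs), ?_⟩
    rw [heq]
    change Polynomial.C s • w _ + _ - Polynomial.C s • w _ ∈ _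
    rw [add_sub_cancel_left]
    exact Submodule.smul_mem _ _ (mem_lowerSpan mo w (mo.toSyn_strictMono hγ))
  have hspan : Submodule.span k[X] (Set.range w) = ⊤ := by
    set N := Submodule.span k[X] (Set.range w)
    have hxN : ∀ i, N ≤ N.comap (x i) := fun i => by
      refine Submodule.span_le.2 ?_
      rintro _ ⟨α, rfl⟩
      obtain ⟨s, t, γ, -, -, heq⟩ := hxw i α
      change x i (w α) ∈ N
      rw [heq]
      exact add_mem (N.smul_mem _ (Submodule.subset_span ⟨_, rfl⟩))
        (N.smul_mem _ (Submodule.subset_span ⟨_, rfl⟩))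
    -- The elements preserving `N` form a subalgebra containing all generators, so `N` is an
    -- `A`-submodule; it contains `v ≠ 0`, hence is everything by simplicity.
    let T : Subalgebra k A :=
      { carrier := {t | ∀ n ∈ N, t • n ∈ N}
        mul_mem' := fun hs ht n hn => by rw [mul_smul]; exact hs _ (ht _ hn)
        add_mem' := fun hs ht n hn => by rw [add_smul]; exact add_mem (hs _ hn) (ht _ hn)
        algebraMap_mem' := fun r n hn => by
          have := N.smul_mem (Polynomial.C r) hn
          rwa [hsmul, aeval_C] at this }
    have hT : ∀ t, t ∈ T := fun t => by
      have : (⊤ : Subalgebra k A) ≤ T := by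
        rw [← hgen]
        refine Algebra.adjoin_le ?_
        rintro t (rfl | rfl | rfl | rfl | rfl | rfl)
        · intro n hn
          have := N.smul_mem X hn
          rwa [hsmul, aeval_X] at this
        · exact hxN 0
        · exact hxN 1
        · exact hxN 2
        · exact hxN 3
        · exact hxN 4
      exact this Algebra.mem_top
    let N' : Submodule A M := { N with smul_mem' := fun t n hn => hT t n hn }
    have hvN : v ∈ N' := by
      rw [← hw0]
      exact Submodule.subset_span ⟨0, rfl⟩
    rcases eq_bot_or_eq_top N' with hN | hN
    · rw [hN, Submodule.mem_bot] at hvN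
      exact absurd hvN hv
    · refine (Submodule.eq_top_iff').2 fun m => ?_
      have : m ∈ N' := by rw [hN]; exact Submodule.mem_top
      exact this
  -- A polynomial in the central element `a` acts by a module endomorphism, nonzero on `v` by
  -- assumption; Schur's lemma makes it surjective.
  have hsurj : ∀ g : k[X], g ≠ 0 → ∃ m : M, g • m = w 0 := fun g hg => by
    let φ : M →ₗ[A] M :=
      { toFun := fun m => aeval a g • m
        map_add' := fun m m' => smul_add _ m m'
        map_smul' := fun t m => by rw [RingHom.id_apply, smul_smul, smul_smul, hcen] }
    have hφ : φ ≠ 0 := fun h0 => hcon g hg (DFunLike.congr_fun h0 v)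
    exact (LinearMap.surjective_of_ne_zero hφ) _
  -- Over an infinite field some `c` is not a root of `f`, and then `X - c` divides no power of `f`.
  have hR : ∀ f : k[X], f ≠ 0 → ∃ g : k[X], g ≠ 0 ∧ ∀ n : ℕ, ¬ g ∣ f ^ n := fun f hf => by
    obtain ⟨c, hc⟩ : ∃ c, ¬ f.IsRoot c := by
      by_contra! hall
      exact hf (Polynomial.funext fun c => by rw [eval_zero]; exact hall c)
    refine ⟨X - Polynomial.C c, X_sub_C_ne_zero c, fun n hn => hc ?_⟩
    have := dvd_iff_isRoot.1 hn
    rw [IsRoot.def, eval_pow] at this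
    exact eq_zero_of_pow_eq_zero this
  obtain ⟨r, hr, hr0⟩ := exists_smul_eq_zero_of_monomial_family hx hspan hsurj hR
  rw [hw0] at hr0
  exact hcon r hr hr0

end IsReorderable

open Polynomial in
-- Write `r = (X - c) s`. Either `s` already kills `v`, and the degree drops, or `s(a) v` is the
-- desired eigenvector.
theorem exists_smul_eq_of_aeval_smul_eq_zero [IsAlgClosed k] {M : Type*} [AddCommGroup M]
    [Module A M] {a : A} {v : M} (hv : v ≠ 0) {r : k[X]} (hr : r ≠ 0) (h : aeval a r • v = 0) :
    ∃ (c : k) (m : M), m ≠ 0 ∧ a • m = algebraMap k A c • m := by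
  induction hn : r.natDegree generalizing r with
  | zero =>
    rw [eq_C_of_natDegree_eq_zero hn] at h hr
    have hc : r.coeff 0 ≠ 0 := fun h0 => hr (by rw [h0, C_0])
    rw [aeval_C] at h
    have := congrArg (algebraMap k A (r.coeff 0)⁻¹ • ·) h
    simp only [smul_smul, ← map_mul, inv_mul_cancel₀ hc, map_one, one_smul, smul_zero] at this
    exact absurd this hv
  | succ n ih =>
    have hdeg : r.degree ≠ 0 := fun h0 => by
      have := natDegree_eq_zero_iff_degree_le_zero.2 h0.le
      omega
    obtain ⟨c, hc⟩ := IsAlgClosed.exists_root r hdeg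
    obtain ⟨s, rfl⟩ := dvd_iff_isRoot.2 hc
    have hs : s ≠ 0 := right_ne_zero_of_mul hr
    by_cases hsv : aeval a s • v = 0
    · refine ih hs hsv ?_
      rw [natDegree_mul (X_sub_C_ne_zero c) hs, natDegree_X_sub_C] at hn
      omega
    · refine ⟨c, aeval a s • v, hsv, ?_⟩
      rwa [map_mul, map_sub, aeval_X, aeval_C, mul_smul, sub_smul, sub_eq_zero] at h

/-- The element `a` of its centralizer. -/
def aCA (k : Type u) [Field k] (q : kˣ) : CA k q := ⟨Dq.of k q .a, Dq.mem_CA.2 rfl⟩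

theorem mul_aCA {k : Type u} [Field k] {q : kˣ} (t : CA k q) : t * aCA k q = aCA k q * t :=
  Subtype.ext (Dq.mem_CA.1 t.2).symm

/-- The element `a` acts on each simple `C(a, D_q)`-module by a nonzero scalar. -/
theorem exists_unit_smul_eq {k : Type u} [Field k] [IsAlgClosed k] {q : kˣ}
    (hq : ∀ n : ℕ, 0 < n → q ^ n ≠ 1) (M : Type v) [AddCommGroup M] [Module (CA k q) M]
    [IsSimpleModule (CA k q) M] :
    ∃ μ : kˣ, ∀ m : M, aCA k q • m = algebraMap k (CA k q) μ • m := by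
  have h := Dq.isTorusWeyl k q
  have hq2 : (q : k) ^ 2 ≠ 0 := pow_ne_zero 2 q.ne_zero
  have hmem : ∀ {x}, x ∈ ({Dq.of k q .a, Dq.of k q .ainv, Dq.e k q, Dq.y k q, Dq.z k q,
      Dq.f k q} : Set (Dq k q)) → x ∈ CA k q := fun hx =>
    Dq.torusCentralizer_le_CA k q (Algebra.subset_adjoin hx)
  let a' : CA k q := ⟨Dq.of k q .ainv, hmem (by simp)⟩
  let e : CA k q := ⟨Dq.e k q, hmem (by simp)⟩
  let y : CA k q := ⟨Dq.y k q, hmem (by simp)⟩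
  let z : CA k q := ⟨Dq.z k q, hmem (by simp)⟩
  let f : CA k q := ⟨Dq.f k q, hmem (by simp)⟩
  have hre : IsReorderable k a' e y z f :=
    { ea' := Subtype.ext h.a'e.symm
      ya' := Subtype.ext h.a'y.symm
      za' := Subtype.ext h.a'z.symm
      fa' := Subtype.ext h.a'f.symm
      ye := ⟨_, _, inv_ne_zero hq2, Subtype.ext h.ye⟩
      ze := ⟨_, inv_ne_zero hq2, Subtype.ext h.ze⟩
      fe := ⟨_, hq2, Subtype.ext h.fe⟩
      zy := ⟨_, hq2, Subtype.ext h.zy⟩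
      fy := ⟨_, inv_ne_zero hq2, Subtype.ext h.fy⟩
      fz := ⟨_, _, inv_ne_zero hq2, Subtype.ext h.fz⟩ }
  have hgen : Algebra.adjoin k {aCA k q, a', e, y, z, f} = ⊤ := by
    apply Subalgebra.map_injective (f := (CA k q).val) Subtype.val_injective
    rw [← Algebra.adjoin_image, Algebra.map_top, Subalgebra.range_val]
    refine Eq.trans ?_ (Dq.CA_eq_torusCentralizer hq).symm
    rw [Dq.torusCentralizer]
    congr 1
    simp only [Set.image_insert_eq, Set.image_singleton]
    rfl
  have : Nontrivial M := IsSimpleModule.nontrivial (CA k q) M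
  have : Infinite k := IsAlgClosed.instInfinite
  obtain ⟨v, hv⟩ := exists_ne (0 : M)
  obtain ⟨r, hr, hrv⟩ := hre.exists_aeval_smul_eq_zero mul_aCA hgen hv
  obtain ⟨c, m, hm, hc⟩ := exists_smul_eq_of_aeval_smul_eq_zero hv hr hrv
  -- The element `a` is invertible in its centralizer.
  have hc0 : c ≠ 0 := by
    rintro rfl
    have h1 := congrArg (a' • ·) hc
    have h2 : a' * aCA k q = 1 := Subtype.ext h.a'a
    simp only [smul_smul, h2, one_smul, map_zero, zero_smul, smul_zero] at h1
    exact hm h1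
  -- As `a` is central, `a - c` is a module endomorphism. It kills `m ≠ 0`, so by Schur's lemma it
  -- is zero.
  let φ : M →ₗ[CA k q] M :=
    { toFun := fun m => aCA k q • m - algebraMap k (CA k q) c • m
      map_add' := fun m m' => by rw [smul_add, smul_add, add_sub_add_comm]
      map_smul' := fun t m => by
        rw [RingHom.id_apply, smul_sub, smul_smul, smul_smul, smul_smul, smul_smul, mul_aCA,
          Algebra.commutes] }
  refine ⟨Units.mk0 c hc0, fun m' => ?_⟩
  have hφ : φ = 0 := by
    by_contra hne
    exact hm (LinearMap.injective_of_ne_zero hne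
      ((sub_eq_zero.2 hc : φ m = 0).trans (map_zero φ).symm))
  exact sub_eq_zero.1 (DFunLike.congr_fun hφ m' : φ m' = 0)

end CentralCharacter

/-! ### Supports and weight spaces -/

section WeightModules

/-- In a finite-dimensional representation of a quantum Weyl algebra with parameter not a root of
unity, the generator `e` acts injectively. -/
theorem injective_of_quantum_weyl {k W : Type*} [Field k] [AddCommGroup W] [Module k W]
    [FiniteDimensional k W] {e y : Module.End k W} {s t : k}
    (hs : ∀ m n : ℕ, s ^ m = s ^ n → m = n)
    (ht : t ≠ 0) (h : e * y = s • (y * e) + t • 1) : Function.Injective e := by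
  rw [injective_iff_map_eq_zero]
  intro v hev
  by_contra hv
  -- With `e v = 0`, the vector `yⁿ v` is an eigenvector of `y e` with eigenvalue `c n = t (1 + s +
  -- ⋯ + sⁿ⁻¹)`. These would be infinitely many distinct eigenvalues in finite dimension.
  let c : ℕ → k := fun n => Nat.rec 0 (fun _ x => s * x + t) n
  have hc1 : ∀ n, c (n + 1) = s * c n + t := fun _ => rfl
  -- The closed form of the geometric sum without division by `s - 1`; it shows that `c` is
  -- injective.
  have hc : ∀ n, (s - 1) * c n + t = s ^ n * t := fun n => by
    induction n with
    | zero => simp [c]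
    | succ n ih => rw [hc1, pow_succ', mul_assoc, ← ih]; ring
  have hcinj : Function.Injective c := fun m n hmn => hs m n (mul_right_cancel₀ ht (by
    rw [← hc, ← hc, hmn]))
  have hey : ∀ w, e (y w) = s • y (e w) + t • w := fun w => by
    have := LinearMap.congr_fun h w
    simpa using this
  have hye : ∀ n, y (e ((y ^ n) v)) = c n • (y ^ n) v ∧
      e ((y ^ (n + 1)) v) = c (n + 1) • (y ^ n) v := fun n => by
    induction n with
    | zero =>
      refine ⟨by simp [hev, c], ?_⟩
      rw [zero_add, pow_one, hey, hev]
      simp [c]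
    | succ n ih =>
      have h1 : y (e ((y ^ (n + 1)) v)) = c (n + 1) • (y ^ (n + 1)) v := by
        rw [ih.2, map_smul, pow_succ', Module.End.mul_apply]
      refine ⟨h1, ?_⟩
      rw [pow_succ' y (n + 1), Module.End.mul_apply, hey, h1, smul_smul, ← add_smul, hc1 (n + 1)]
  have hne : ∀ n, (y ^ n) v ≠ 0 := fun n => by
    induction n with
    | zero => simpa using hv
    | succ n ih =>
      intro h0
      have := (hye n).2
      rw [h0, map_zero] at this
      rcases smul_eq_zero.1 this.symm with h | h
      · have : n + 1 = 0 := hcinj (h.trans rfl)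
        omega
      · exact ih h
  have hev : ∀ n, Module.End.HasEigenvalue (y * e) (c n) := fun n =>
    Module.End.hasEigenvalue_of_hasEigenvector
      (Module.End.hasEigenvector_iff.2 ⟨Module.End.mem_eigenspace_iff.2 (hye n).1, hne n⟩)
  exact Set.infinite_of_injective_forall_mem hcinj hev (Module.End.finite_hasEigenvalue (y * e))

theorem Kunit_zpow_smul_injective {k : Type u} [Field k] {q : kˣ} {V : Type v}
    [AddCommGroup V] [Module (Dq k q) V] (i : ℤ) :
    Function.Injective fun x : V => ((Dq.Kunit k q ^ i : (Dq k q)ˣ) : Dq k q) • x := by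
  intro x y hxy
  have := congrArg (((Dq.Kunit k q ^ (-i) : (Dq k q)ˣ) : Dq k q) • ·) hxy
  simpa only [smul_smul, ← Units.val_mul, ← zpow_add, neg_add_cancel, zpow_zero, Units.val_one,
    one_smul] using this

variable {k : Type u} [Field k] {q : kˣ} {V : Type v} [AddCommGroup V] [Module k V]
  [Module (Dq k q) V] [IsScalarTower k (Dq k q) V]

theorem smul_comm_scalar (d : Dq k q) (c : k) (x : V) : d • c • x = c • d • x := by
  rw [← algebraMap_smul (Dq k q) c x, smul_smul, ← Algebra.commutes, mul_smul, algebraMap_smul]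

theorem iSupIndep_weightSpace : iSupIndep (weightSpace k q V) :=
  (Module.End.eigenspaces_iSupIndep (Algebra.lsmul k k V (Dq.of k q .a))).comp Units.val_injective

theorem isAWeight_iff : IsAWeight k q V ↔ ⨆ μ, weightSpace k q V μ = ⊤ := by
  classical
  rw [IsAWeight]
  have := DirectSum.isInternal_submodule_iff_iSupIndep_and_iSup_eq_top (weightSpace k q V)
  convert this using 1
  exact ⟨fun h => ⟨iSupIndep_weightSpace, h⟩, fun h => h.2⟩

theorem smul_mem_weightSpace {i : ℤ} {d : Dq k q} (hd : d ∈ Dq.gr k q i) {μ : kˣ} {x : V}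
    (hx : x ∈ weightSpace k q V μ) : d • x ∈ weightSpace k q V (q ^ i * μ) := by
  have hx' := (mem_weightSpace k q V μ x).1 hx
  refine (mem_weightSpace k q V _ _).2 ?_
  rw [smul_smul, Dq.mem_gr.1 hd, smul_assoc, mul_smul, hx', smul_comm_scalar, smul_smul,
    Units.val_mul]

theorem CA_smul_mem_weightSpace (t : CA k q) {μ : kˣ} {x : V}
    (hx : x ∈ weightSpace k q V μ) : (t : Dq k q) • x ∈ weightSpace k q V μ := by
  have := smul_mem_weightSpace (Dq.mem_gr_zero.2 t.2) hx
  rwa [zpow_zero, one_mul] at this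

theorem iSupIndep_weightSpace_orbit (hq : ∀ n : ℕ, 0 < n → q ^ n ≠ 1) (μ : kˣ) :
    iSupIndep fun i : ℤ => weightSpace k q V (q ^ i * μ) :=
  iSupIndep_weightSpace.comp fun _ _ h => zpow_injective_of_not_root hq (mul_right_cancel h)

/-- If the components of a sum of weight vectors of distinct weights `qⁱμ` add up to an element
of a submodule, then all of them lie in it. -/
theorem mem_of_sum_mem (hq : ∀ n : ℕ, 0 < n → q ^ n ≠ 1) {μ : kˣ} (N : Submodule (Dq k q) V)
    {s : Finset ℤ} {x : ℤ → V} (hx : ∀ i ∈ s, x i ∈ weightSpace k q V (q ^ i * μ))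
    (h : ∑ i ∈ s, x i ∈ N) {i : ℤ} (hi : i ∈ s) : x i ∈ N := by
  -- Weight vectors stay weight vectors in `V ⧸ N`, where their sum is zero; independence there
  -- kills each of them.
  have hind := iSupIndep_weightSpace_orbit (V := V ⧸ N) hq μ
  rw [iSupIndep_iff_finsetSum_eq_zero_imp_eq_zero] at hind
  refine (Submodule.Quotient.mk_eq_zero N).1
    (hind s (fun i => Submodule.Quotient.mk (x i)) (fun i hi => ?_) ?_ i hi)
  · have := (mem_weightSpace k q V _ _).1 (hx i hi)
    rw [mem_weightSpace, ← Submodule.Quotient.mk_smul, this, Submodule.Quotient.mk_smul]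
  · rw [← (Submodule.Quotient.mk_eq_zero N).2 h]
    exact (map_sum N.mkQ x s).symm

theorem iSup_orbit_smul_mem {μ : kˣ} (d : Dq k q) {x : V}
    (hx : x ∈ ⨆ i : ℤ, weightSpace k q V (q ^ i * μ)) :
    d • x ∈ ⨆ i : ℤ, weightSpace k q V (q ^ i * μ) := by
  have hd : d ∈ ⨆ j, Dq.gr k q j := by rw [Dq.iSup_gr]; exact Submodule.mem_top
  refine Submodule.iSup_induction _
    (motive := fun d => d • x ∈ ⨆ i : ℤ, weightSpace k q V (q ^ i * μ)) hd
    (fun j d hd => ?_) (by rw [zero_smul]; exact zero_mem _)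
    (fun d d' h h' => by rw [add_smul]; exact add_mem h h')
  refine Submodule.iSup_induction _
    (motive := fun x => d • x ∈ ⨆ i : ℤ, weightSpace k q V (q ^ i * μ)) hx
    (fun i x hx => Submodule.mem_iSup_of_mem (j + i) ?_) (by rw [smul_zero]; exact zero_mem _)
    (fun x x' h h' => by rw [smul_add]; exact add_mem h h')
  rw [zpow_add, mul_assoc]
  exact smul_mem_weightSpace hd hx

/-- Homogeneous elements of `D_q` move weights by powers of `q`, so the sum over one orbit is a
nonzero `D_q`-submodule. -/
theorem iSup_orbit_eq_top [IsSimpleModule (Dq k q) V] {μ : kˣ} (hμ : μ ∈ supp k q V) :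
    ⨆ i : ℤ, weightSpace k q V (q ^ i * μ) = ⊤ := by
  let N : Submodule (Dq k q) V :=
    { (⨆ i : ℤ, weightSpace k q V (q ^ i * μ) : Submodule k V) with
      smul_mem' := fun d x hx => iSup_orbit_smul_mem d hx }
  obtain ⟨x, hx, hx0⟩ := Submodule.exists_mem_ne_zero_of_ne_bot hμ
  have hxN : x ∈ N := Submodule.mem_iSup_of_mem (0 : ℤ) (by rwa [zpow_zero, one_mul])
  rcases eq_bot_or_eq_top N with hN | hN
  · rw [hN, Submodule.mem_bot] at hxN
    exact absurd hxN hx0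
  · refine (Submodule.eq_top_iff').2 fun m => ?_
    have : m ∈ N := by rw [hN]; exact Submodule.mem_top
    exact this

theorem mem_range_of_iSup_orbit_eq_top {μ ν : kˣ}
    (h : ⨆ i : ℤ, weightSpace k q V (q ^ i * μ) = ⊤) (hν : ν ∈ supp k q V) :
    ν ∈ Set.range fun i : ℤ => q ^ i * μ := by
  by_contra hcon
  refine hν ?_
  have hd : Disjoint (weightSpace k q V ν) (⨆ (ν') (_ : ν' ≠ ν), weightSpace k q V ν') :=
    iSupIndep_weightSpace ν
  have htop : ⨆ (ν') (_ : ν' ≠ ν), weightSpace k q V ν' = ⊤ := by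
    rw [← top_le_iff, ← h]
    exact iSup_le fun i => le_iSup₂_of_le (q ^ i * μ) (fun hi => hcon ⟨i, hi⟩) le_rfl
  rwa [htop, disjoint_top] at hd

theorem zpow_mul_mem_supp {μ : kˣ} (hμ : μ ∈ supp k q V) (i : ℤ) : q ^ i * μ ∈ supp k q V := by
  obtain ⟨x, hx, hx0⟩ := Submodule.exists_mem_ne_zero_of_ne_bot hμ
  refine (Submodule.ne_bot_iff _).2
    ⟨_, smul_mem_weightSpace (Dq.Kunit_zpow_mem_gr k q i) hx, fun h => hx0 ?_⟩
  exact Kunit_zpow_smul_injective (k := k) (q := q) i (h.trans (smul_zero _).symm)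

theorem supp_eq_range [IsSimpleModule (Dq k q) V] {μ : kˣ} (hμ : μ ∈ supp k q V) :
    supp k q V = Set.range fun i : ℤ => q ^ i * μ := by
  refine Set.Subset.antisymm
    (fun ν hν => mem_range_of_iSup_orbit_eq_top (iSup_orbit_eq_top hμ) hν) ?_
  rintro _ ⟨i, rfl⟩
  exact zpow_mul_mem_supp hμ i

theorem supp_nonempty [Nontrivial V] (h : IsAWeight k q V) : (supp k q V).Nonempty := by
  by_contra hcon
  have hbot : ∀ μ, weightSpace k q V μ = ⊥ := fun μ => by
    by_contra hμ
    exact hcon ⟨μ, hμ⟩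
  rw [isAWeight_iff] at h
  simp only [hbot, iSup_bot] at h
  exact bot_ne_top h

/-- The action of `C(a, D_q)` on a weight space. -/
def weightRep (μ : kˣ) : CA k q →ₐ[k] Module.End k (weightSpace k q V μ) :=
  AlgHom.ofLinearMap
    { toFun := fun t => (Algebra.lsmul k k V (t : Dq k q)).restrict
        fun _ hx => CA_smul_mem_weightSpace t hx
      map_add' := fun s t => by
        ext x
        exact add_smul (s : Dq k q) (t : Dq k q) (x : V)
      map_smul' := fun c t => by
        ext x
        exact smul_assoc c (t : Dq k q) (x : V) }
    (by ext x; exact one_smul (Dq k q) (x : V))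
    (fun s t => by ext x; exact mul_smul (s : Dq k q) (t : Dq k q) (x : V))

/-- If the dimension `n` were finite, the quantum Weyl pairs `(e, y)` and `(f, z)` would make `e`
and `f` injective, hence of nonzero determinant. Then `e f = q⁻² f e` gives `q²ⁿ = 1` with `n > 0`.
-/
theorem not_finiteDimensional_weightSpace (hq : ∀ n : ℕ, 0 < n → q ^ n ≠ 1) {μ : kˣ}
    (hμ : μ ∈ supp k q V) : ¬ FiniteDimensional k (weightSpace k q V μ) := by
  intro hfin
  have h := Dq.isTorusWeyl k q
  have hmem : ∀ {x}, x ∈ ({Dq.of k q .a, Dq.of k q .ainv, Dq.e k q, Dq.y k q, Dq.z k q,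
      Dq.f k q} : Set (Dq k q)) → x ∈ CA k q := fun hx =>
    Dq.torusCentralizer_le_CA k q (Algebra.subset_adjoin hx)
  let ρ := weightRep (V := V) (q := q) μ
  let e : CA k q := ⟨Dq.e k q, hmem (by simp)⟩
  let y : CA k q := ⟨Dq.y k q, hmem (by simp)⟩
  let z : CA k q := ⟨Dq.z k q, hmem (by simp)⟩
  let f : CA k q := ⟨Dq.f k q, hmem (by simp)⟩
  have hq' : ∀ n : ℕ, 0 < n → (q : k) ^ n ≠ 1 := fun n hn h1 =>
    hq n hn (Units.ext (by rw [Units.val_pow_eq_pow_val, h1, Units.val_one]))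
  have hpow : ∀ m n : ℕ, (q : k) ^ m = (q : k) ^ n → m = n := fun m n hmn =>
    Nat.cast_injective (R := ℤ) (zpow_injective_of_not_root hq (by
      simp only [zpow_natCast]
      exact Units.ext (by simpa using hmn)))
  have hs1 : ∀ m n : ℕ, ((q : k) ^ 2) ^ m = ((q : k) ^ 2) ^ n → m = n := fun m n hmn => by
    rw [← pow_mul, ← pow_mul] at hmn
    have := hpow _ _ hmn
    omega
  have hs2 : ∀ m n : ℕ, (((q : k) ^ 2)⁻¹) ^ m = (((q : k) ^ 2)⁻¹) ^ n → m = n := fun m n hmn => by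
    rw [inv_pow, inv_pow, inv_inj] at hmn
    exact hs1 m n hmn
  have hey : e * y = (q : k) ^ 2 • (y * e) + (1 : k) • 1 :=
    Subtype.ext (h.ey.trans (by rw [← one_smul k (1 : Dq k q)]; simp; rfl))
  have hfz : f * z = ((q : k) ^ 2)⁻¹ • (z * f) + (q : k) • 1 := Subtype.ext h.fz
  have hef : e * f = ((q : k) ^ 2)⁻¹ • (f * e) := Subtype.ext h.ef
  have he : Function.Injective (ρ e) := injective_of_quantum_weyl hs1 one_ne_zero
    (y := ρ y) (by rw [← map_mul, hey, map_add, map_smul, map_smul, map_mul, map_one])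
  have hf : Function.Injective (ρ f) := injective_of_quantum_weyl hs2 q.ne_zero
    (y := ρ z) (by rw [← map_mul, hfz, map_add, map_smul, map_smul, map_mul, map_one])
  have hdet : ∀ {φ : Module.End k (weightSpace k q V μ)}, Function.Injective φ →
      LinearMap.det φ ≠ 0 := fun {φ} hφ h0 => by
    have := LinearMap.bot_lt_ker_of_det_eq_zero h0
    rw [LinearMap.ker_eq_bot.2 hφ] at this
    exact lt_irrefl _ this
  have hρ : ρ e * ρ f = ((q : k) ^ 2)⁻¹ • (ρ f * ρ e) := by
    rw [← map_mul, hef, map_smul, map_mul]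
  have hd := congrArg LinearMap.det hρ
  rw [map_mul, LinearMap.det_smul, map_mul, mul_comm (LinearMap.det (ρ f))] at hd
  have h1 := (mul_eq_right₀ (mul_ne_zero (hdet he) (hdet hf))).1 hd.symm
  rw [inv_pow, inv_eq_one, ← pow_mul] at h1
  have hpos : 0 < Module.finrank k (weightSpace k q V μ) := by
    have : Nontrivial (weightSpace k q V μ) := Submodule.nontrivial_iff_ne_bot.2 hμ
    exact Module.finrank_pos
  exact hq' _ (Nat.mul_pos two_pos hpos) h1

end WeightModules

/-! ### Induction from `C(a, D_q)` and the classification of simple weight modules -/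

section InducedModules

namespace Ind

variable {k : Type u} [Field k] {D : Type u} [Ring D] [Algebra k D] (S : Subalgebra k D)
  (M : Type v) [AddCommGroup M] [Module S M]

/-- The canonical map `m ↦ 1 ⊗ m` from `M` to the induced module. -/
def unit : M →ₗ[S] Ind S M where
  toFun m := Submodule.Quotient.mk ((1 : D) ⊗ₜ[ℤ] m)
  map_add' m m' := by
    rw [TensorProduct.tmul_add]
    rfl
  map_smul' s m := by
    have h : ((s : D) * 1) ⊗ₜ[ℤ] m - (1 : D) ⊗ₜ[ℤ] (s • m) ∈ balancedRel S M :=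
      Submodule.subset_span ⟨1, s, m, by rw [mul_one, one_mul]⟩
    exact ((Submodule.Quotient.eq _).2 h).symm

theorem smul_unit (d : D) (m : M) :
    d • unit S M m = (Submodule.Quotient.mk (d ⊗ₜ[ℤ] m) : (D ⊗[ℤ] M) ⧸ balancedRel S M) := by
  change (Submodule.Quotient.mk (d • ((1 : D) ⊗ₜ[ℤ] m)) : (D ⊗[ℤ] M) ⧸ balancedRel S M) = _
  rw [TensorProduct.smul_tmul', smul_eq_mul, mul_one]

variable {S M}

theorem mul_smul_unit (d : D) (s : S) (m : M) :
    (d * (s : D)) • unit S M m = d • unit S M (s • m) := by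
  rw [mul_smul, map_smul]
  rfl

theorem induction_on {motive : Ind S M → Prop} (x : Ind S M) (zero : motive 0)
    (smul : ∀ (d : D) (m : M), motive (d • unit S M m))
    (add : ∀ x y, motive x → motive y → motive (x + y)) : motive x := by
  obtain ⟨t, rfl⟩ := Submodule.Quotient.mk_surjective (balancedRel S M) x
  induction t using TensorProduct.induction_on with
  | zero => exact zero
  | tmul d m => rw [← smul_unit]; exact smul d m
  | add t t' h h' => exact add _ _ h h'

/-- The linear map out of an induced module given by Frobenius reciprocity. -/
def lift {V : Type*} [AddCommGroup V] [Module D V] (g : M →ₗ[S] V) : Ind S M →ₗ[D] V :=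
  (balancedRel S M).liftQ
    (TensorProduct.AlgebraTensorModule.lift
      (LinearMap.toSpanSingleton D (M →ₗ[ℤ] V) g.toAddMonoidHom.toIntLinearMap)) (by
    refine Submodule.span_le.2 ?_
    rintro _ ⟨d, s, m, rfl⟩
    change _ = _
    rw [map_sub, sub_eq_zero]
    change (d * (s : D)) • g m = d • g (s • m)
    rw [map_smul, mul_smul]
    rfl)

theorem lift_unit {V : Type*} [AddCommGroup V] [Module D V] (g : M →ₗ[S] V) (m : M) :
    lift g (unit S M m) = g m :=
  one_smul D (g m)

end Ind

variable {k : Type u} [Field k] {q : kˣ}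

/-- The projection of `D_q` onto degree zero induces a retraction: `d ⊗ m ↦ proj d • m` kills the
balancing relations and sends `1 ⊗ m` back to `m`. -/
theorem unit_injective (hq : ∀ n : ℕ, 0 < n → q ^ n ≠ 1) (M : Type v) [AddCommGroup M]
    [Module (CA k q) M] : Function.Injective (Ind.unit (CA k q) M) := by
  let φ : Dq k q ⊗[ℤ] M →+ M := TensorProduct.liftAddHom
    (AddMonoidHom.mk' (fun d => AddMonoidHom.mk' (fun m : M => Dq.proj hq d • m)
      fun m m' => smul_add _ m m') fun d d' => by
        ext m
        change Dq.proj hq (d + d') • m = Dq.proj hq d • m + Dq.proj hq d' • m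
        rw [Dq.proj_add, add_smul])
    fun r d m => by rw [map_zsmul, map_zsmul, AddMonoidHom.smul_apply]
  have hφ : ∀ d m, φ (d ⊗ₜ m) = Dq.proj hq d • m := fun _ _ => rfl
  -- The relations are a `D_q`-span while `φ` is only additive, so the induction must carry an
  -- arbitrary left factor `d`.
  have hker : ∀ x ∈ balancedRel (CA k q) M, ∀ d : Dq k q, φ (d • x) = 0 := fun x hx => by
    induction hx using Submodule.span_induction with
    | mem x hx =>
      obtain ⟨d, s, m, rfl⟩ := hx
      intro d'
      rw [smul_sub, TensorProduct.smul_tmul', TensorProduct.smul_tmul', smul_eq_mul, smul_eq_mul,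
        map_sub, hφ, hφ, ← mul_assoc, Dq.proj_mul, mul_smul, sub_self]
    | zero => intro d; rw [smul_zero, map_zero]
    | add x y _ _ hx hy => intro d; rw [smul_add, map_add, hx, hy, add_zero]
    | smul c x _ hx => intro d; rw [smul_smul]; exact hx _
  rw [injective_iff_map_eq_zero]
  intro m hm
  have := hker _ ((Submodule.Quotient.mk_eq_zero _).1 hm) 1
  rwa [one_smul, hφ, show (1 : Dq k q) = ((1 : CA k q) : Dq k q) from rfl, Dq.proj_of_mem,
    one_smul] at this

/-- The identity map from a twist to the original module. -/
def untwist {k R : Type*} [CommRing k] [Ring R] [Algebra k R] (σ : R ≃ₐ[k] R) (M : Type v)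
    [AddCommGroup M] [Module R M] : Twist σ M ≃+ M := AddEquiv.refl M

theorem untwist_smul {k R : Type*} [CommRing k] [Ring R] [Algebra k R] (σ : R ≃ₐ[k] R)
    (M : Type v) [AddCommGroup M] [Module R M] (r : R) (m : Twist σ M) :
    untwist σ M (r • m) = σ r • untwist σ M m := rfl

theorem coe_tauK_zpow (i : ℤ) (t : CA k q) :
    (((tauK k q ^ i) t : CA k q) : Dq k q)
      = ((Dq.Kunit k q ^ (-i) : (Dq k q)ˣ) : Dq k q) * t *
        ((Dq.Kunit k q ^ i : (Dq k q)ˣ) : Dq k q) := by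
  induction i generalizing t with
  | zero => simp
  | succ n ih =>
    have e1 : Dq.Kunit k q ^ (-(n + 1) : ℤ) = Dq.Kunit k q ^ (-n : ℤ) * (Dq.Kunit k q)⁻¹ := by
      rw [neg_add, zpow_add, zpow_neg_one]
    have e2 : Dq.Kunit k q ^ (n + 1 : ℤ) = Dq.Kunit k q * Dq.Kunit k q ^ (n : ℤ) := by
      rw [add_comm, zpow_add, zpow_one]
    have e3 : ((tauK k q t : CA k q) : Dq k q)
        = (((Dq.Kunit k q)⁻¹ : (Dq k q)ˣ) : Dq k q) * t * (Dq.Kunit k q : Dq k q) := rfl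
    rw [zpow_add_one, AlgEquiv.mul_apply, ih, e1, e2, e3, Units.val_mul, Units.val_mul]
    simp only [mul_assoc]
  | pred n ih =>
    have e1 : Dq.Kunit k q ^ (-(-n - 1) : ℤ) = Dq.Kunit k q ^ (- -n : ℤ) * Dq.Kunit k q := by
      rw [neg_sub, sub_eq_add_neg, add_comm, zpow_add, zpow_one]
    have e2 : Dq.Kunit k q ^ (-n - 1 : ℤ) = (Dq.Kunit k q)⁻¹ * Dq.Kunit k q ^ (-n : ℤ) := by
      rw [sub_eq_add_neg, add_comm, zpow_add, zpow_neg_one]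
    have e3 : (((tauK k q)⁻¹ t : CA k q) : Dq k q)
        = (Dq.Kunit k q : Dq k q) * t * (((Dq.Kunit k q)⁻¹ : (Dq k q)ˣ) : Dq k q) := rfl
    rw [zpow_sub_one, AlgEquiv.mul_apply, ih, e1, e2, e3, Units.val_mul, Units.val_mul]
    simp only [mul_assoc]

variable {M : Type v} [AddCommGroup M] [Module (CA k q) M]

variable (M) in
/-- The embedding of the twist of `M` by `τ_Kⁱ` into the induced module, with image `Kⁱ ⊗ M`. -/
def twistUnit (i : ℤ) : Twist (tauK k q ^ i) M →ₗ[CA k q] Ind (CA k q) M where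
  toFun m := ((Dq.Kunit k q ^ i : (Dq k q)ˣ) : Dq k q) • Ind.unit (CA k q) M (untwist _ M m)
  map_add' m m' := by
    rw [map_add, map_add, smul_add]
  -- Equivariance is `t Kⁱ = Kⁱ (K⁻ⁱ t Kⁱ) = Kⁱ τ_Kⁱ(t)`, the last factor being absorbed by `M`.
  map_smul' t m := by
    change _ = (t : Dq k q) • ((Dq.Kunit k q ^ i : (Dq k q)ˣ) : Dq k q) •
      Ind.unit (CA k q) M (untwist _ M m)
    rw [untwist_smul, ← Ind.mul_smul_unit, coe_tauK_zpow, smul_smul, ← mul_assoc, ← mul_assoc,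
      ← Units.val_mul, ← zpow_add, add_neg_cancel, zpow_zero, Units.val_one, one_mul]

theorem twistUnit_injective (hq : ∀ n : ℕ, 0 < n → q ^ n ≠ 1) (i : ℤ) :
    Function.Injective (twistUnit (k := k) (q := q) M i) := fun _ _ h =>
  (untwist _ M).injective (unit_injective hq M (Kunit_zpow_smul_injective (k := k) (q := q) i h))

instance isSimpleModule_twist {k R : Type*} [CommRing k] [Ring R] [Algebra k R] (σ : R ≃ₐ[k] R)
    (M : Type v) [AddCommGroup M] [Module R M] [IsSimpleModule R M] :
    IsSimpleModule R (Twist σ M) := by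
  have hn : Nontrivial M := IsSimpleModule.nontrivial R M
  refine isSimpleModule_iff_toSpanSingleton_surjective.2
    ⟨(untwist σ M).toEquiv.nontrivial, fun x hx y => ?_⟩
  have hx' : untwist σ M x ≠ 0 := fun h => hx ((AddEquiv.map_eq_zero_iff _).1 h)
  obtain ⟨r, hr⟩ := IsSimpleModule.toSpanSingleton_surjective R hx' (untwist σ M y)
  refine ⟨σ.symm r, (untwist σ M).injective ?_⟩
  rw [LinearMap.toSpanSingleton_apply, untwist_smul, AlgEquiv.apply_symm_apply]
  exact hr

theorem scalar_smul_unit (c : k) (d : Dq k q) (m : M) :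
    c • d • Ind.unit (CA k q) M m = d • Ind.unit (CA k q) M (algebraMap k (CA k q) c • m) := by
  rw [← Ind.mul_smul_unit, ← smul_comm_scalar, ← algebraMap_smul (Dq k q) c, smul_smul]
  rfl

variable (k q M) in
/-- The subspace `Kⁱ ⊗ M` of the induced module. -/
def indGr (i : ℤ) : Submodule k (Ind (CA k q) M) where
  carrier := Set.range (twistUnit (k := k) (q := q) M i)
  zero_mem' := ⟨0, map_zero _⟩
  add_mem' := by
    rintro _ _ ⟨m, rfl⟩ ⟨m', rfl⟩
    exact ⟨m + m', map_add _ m m'⟩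
  smul_mem' := by
    rintro c _ ⟨m, rfl⟩
    refine ⟨(untwist _ M).symm (algebraMap k (CA k q) c • untwist _ M m), ?_⟩
    exact (scalar_smul_unit c ((Dq.Kunit k q ^ i : (Dq k q)ˣ) : Dq k q) (untwist _ M m)).symm

/-- An element `d` of degree `j` equals `Kʲ t` with `t = K⁻ʲ d` of degree zero, so `d ⊗ m = Kʲ ⊗ t
m`. -/
theorem iSup_indGr : ⨆ i, indGr k q M i = ⊤ := by
  refine (Submodule.eq_top_iff').2 fun x => ?_
  induction x using Ind.induction_on with
  | zero => exact zero_mem _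
  | add x y hx hy => exact add_mem hx hy
  | smul d m =>
    have hd : d ∈ ⨆ j, Dq.gr k q j := by rw [Dq.iSup_gr]; exact Submodule.mem_top
    refine Submodule.iSup_induction _
      (motive := fun d => d • Ind.unit (CA k q) M m ∈ ⨆ i, indGr k q M i) hd
      (fun j d hd => Submodule.mem_iSup_of_mem j ?_) (by rw [zero_smul]; exact zero_mem _)
      (fun d d' h h' => by rw [add_smul]; exact add_mem h h')
    have ht := Dq.mul_mem_gr (Dq.Kunit_zpow_mem_gr k q (-j)) hd
    rw [neg_add_cancel, Dq.mem_gr_zero] at ht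
    refine ⟨(untwist _ M).symm ((⟨_, ht⟩ : CA k q) • m), ?_⟩
    change ((Dq.Kunit k q ^ j : (Dq k q)ˣ) : Dq k q) • Ind.unit (CA k q) M
      ((⟨_, ht⟩ : CA k q) • m) = _
    rw [← Ind.mul_smul_unit, ← mul_assoc, ← Units.val_mul, ← zpow_add, add_neg_cancel, zpow_zero,
      Units.val_one, one_mul]

theorem unit_mem_weightSpace {μ : kˣ} (hμ : ∀ m : M, aCA k q • m = algebraMap k (CA k q) μ • m)
    (m : M) : Ind.unit (CA k q) M m ∈ weightSpace k q (Ind (CA k q) M) μ := by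
  rw [mem_weightSpace]
  have h1 : Dq.of k q .a • Ind.unit (CA k q) M m = Ind.unit (CA k q) M (aCA k q • m) :=
    ((Ind.unit (CA k q) M).map_smul (aCA k q) m).symm
  have h2 := scalar_smul_unit (μ : k) (1 : Dq k q) m
  rw [one_smul, one_smul] at h2
  rw [h1, hμ, h2]

theorem indGr_le_weightSpace {μ : kˣ}
    (hμ : ∀ m : M, aCA k q • m = algebraMap k (CA k q) μ • m) (i : ℤ) :
    indGr k q M i ≤ weightSpace k q (Ind (CA k q) M) (q ^ i * μ) := by
  rintro _ ⟨m, rfl⟩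
  exact smul_mem_weightSpace (Dq.Kunit_zpow_mem_gr k q i)
    (unit_mem_weightSpace hμ (untwist _ M m))

theorem iSup_orbit_ind {μ : kˣ} (hμ : ∀ m : M, aCA k q • m = algebraMap k (CA k q) μ • m) :
    ⨆ i : ℤ, weightSpace k q (Ind (CA k q) M) (q ^ i * μ) = ⊤ := by
  rw [← top_le_iff, ← iSup_indGr (M := M)]
  exact iSup_mono (indGr_le_weightSpace hμ)

theorem isAWeight_ind {μ : kˣ} (hμ : ∀ m : M, aCA k q • m = algebraMap k (CA k q) μ • m) :
    IsAWeight k q (Ind (CA k q) M) := by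
  rw [isAWeight_iff, ← top_le_iff, ← iSup_orbit_ind hμ]
  exact iSup_le fun i => le_iSup (weightSpace k q (Ind (CA k q) M)) (q ^ i * μ)

theorem indGr_eq_weightSpace (hq : ∀ n : ℕ, 0 < n → q ^ n ≠ 1) {μ : kˣ}
    (hμ : ∀ m : M, aCA k q • m = algebraMap k (CA k q) μ • m) (i : ℤ) :
    indGr k q M i = weightSpace k q (Ind (CA k q) M) (q ^ i * μ) :=
  iSupIndep_eq_of_le (iSupIndep_weightSpace_orbit hq μ) (indGr_le_weightSpace hμ) iSup_indGr i

/-- A nonzero submodule contains the weight components of its elements, hence some nonzero `Kⁱ ⊗ m`.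
Multiplying by `K⁻ⁱ` gives `1 ⊗ m`, and simplicity of `M` then gives all of `1 ⊗ M`, which
generates. -/
theorem isSimpleModule_ind (hq : ∀ n : ℕ, 0 < n → q ^ n ≠ 1) [IsSimpleModule (CA k q) M] {μ : kˣ}
    (hμ : ∀ m : M, aCA k q • m = algebraMap k (CA k q) μ • m) :
    IsSimpleModule (Dq k q) (Ind (CA k q) M) := by
  have : Nontrivial M := IsSimpleModule.nontrivial (CA k q) M
  have : Nontrivial (Ind (CA k q) M) := (unit_injective hq M).nontrivial
  have key : ∀ N : Submodule (Dq k q) (Ind (CA k q) M), N ≠ ⊥ → N = ⊤ := fun N hN => by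
    obtain ⟨x, hx, hx0⟩ := Submodule.exists_mem_ne_zero_of_ne_bot hN
    have hx' : x ∈ ⨆ i, indGr k q M i := by rw [iSup_indGr]; exact Submodule.mem_top
    obtain ⟨c, hc, rfl⟩ := (Submodule.mem_iSup_iff_exists_finsupp _ _).1 hx'
    obtain ⟨i, hi⟩ : ∃ i, i ∈ c.support := by
      by_contra! hcon
      rw [← Finset.eq_empty_iff_forall_notMem, Finsupp.support_eq_empty] at hcon
      exact hx0 (by rw [hcon, Finsupp.sum_zero_index])
    have hmem : c i ∈ N := mem_of_sum_mem hq N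
      (fun j _ => indGr_le_weightSpace hμ j (hc j)) hx hi
    obtain ⟨m, hm⟩ := hc i
    have hm0 : untwist _ M m ≠ 0 := fun h => by
      rw [AddEquiv.map_eq_zero_iff] at h
      subst h
      exact Finsupp.mem_support_iff.1 hi (hm.symm.trans (map_zero (twistUnit M i)))
    have hmN : Ind.unit (CA k q) M (untwist _ M m) ∈ N := by
      have h1 := N.smul_mem ((Dq.Kunit k q ^ (-i) : (Dq k q)ˣ) : Dq k q) hmem
      rw [← hm] at h1
      change ((Dq.Kunit k q ^ (-i) : (Dq k q)ˣ) : Dq k q) •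
        ((Dq.Kunit k q ^ i : (Dq k q)ˣ) : Dq k q) •
          Ind.unit (CA k q) M (untwist _ M m) ∈ N at h1
      rwa [smul_smul, ← Units.val_mul, ← zpow_add, neg_add_cancel, zpow_zero, Units.val_one,
        one_smul] at h1
    have hall : ∀ m', Ind.unit (CA k q) M m' ∈ N := fun m' => by
      obtain ⟨t, rfl⟩ := IsSimpleModule.toSpanSingleton_surjective (CA k q) hm0 m'
      rw [LinearMap.toSpanSingleton_apply, map_smul]
      exact N.smul_mem (t : Dq k q) hmN
    refine (Submodule.eq_top_iff').2 fun x => ?_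
    induction x using Ind.induction_on with
    | zero => exact zero_mem _
    | add x y hx hy => exact add_mem hx hy
    | smul d m => exact N.smul_mem d (hall m)
  exact { eq_bot_or_eq_top := fun N => or_iff_not_imp_left.2 (key N) }

/-- Frobenius reciprocity extends `g` to a nonzero `D_q`-linear map between simple modules, and
Schur's lemma applies. -/
theorem nonempty_equiv_of_lift_ne_zero {V : Type*} [AddCommGroup V] [Module (Dq k q) V]
    [IsSimpleModule (Dq k q) V] [IsSimpleModule (Dq k q) (Ind (CA k q) M)]
    (g : M →ₗ[CA k q] V) {m : M} (hg : g m ≠ 0) :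
    Nonempty (Ind (CA k q) M ≃ₗ[Dq k q] V) := by
  have hne : Ind.lift g ≠ 0 := fun h0 => hg (by rw [← Ind.lift_unit, h0]; rfl)
  exact ⟨LinearEquiv.ofBijective _ (LinearMap.bijective_of_ne_zero hne)⟩

/-- An isomorphism embeds `M'` into a single weight space of `ind(M)`, of some weight `qⁱ μ`. That
space is `Kⁱ ⊗ M`, a copy of a twist of `M`, and Schur's lemma over `C(a, D_q)` concludes.
Conversely the inclusion of the twist into `ind(M)` extends to `ind(M')` by Frobenius reciprocity.
-/
theorem nonempty_ind_equiv_iff (hq : ∀ n : ℕ, 0 < n → q ^ n ≠ 1) {M' : Type v} [AddCommGroup M']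
    [Module (CA k q) M'] [IsSimpleModule (CA k q) M] [IsSimpleModule (CA k q) M'] {μ μ' : kˣ}
    (hμ : ∀ m : M, aCA k q • m = algebraMap k (CA k q) μ • m)
    (hμ' : ∀ m : M', aCA k q • m = algebraMap k (CA k q) μ' • m) :
    Nonempty (Ind (CA k q) M ≃ₗ[Dq k q] Ind (CA k q) M') ↔
      ∃ i : ℤ, Nonempty (M' ≃ₗ[CA k q] Twist (tauK k q ^ i) M) := by
  have := isSimpleModule_ind hq hμ
  have := isSimpleModule_ind hq hμ'
  have : Nontrivial M' := IsSimpleModule.nontrivial (CA k q) M'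
  obtain ⟨m', hm'⟩ := exists_ne (0 : M')
  constructor
  · rintro ⟨φ⟩
    let g : M' →ₗ[CA k q] Ind (CA k q) M :=
      { toFun := fun m => φ.symm (Ind.unit (CA k q) M' m)
        map_add' := fun m n => by rw [map_add, map_add]
        map_smul' := fun t m => by
          rw [map_smul]
          exact map_smul φ.symm (t : Dq k q) _ }
    have hg0 : g m' ≠ 0 := fun h0 => hm' (unit_injective hq M'
      ((φ.symm.injective (h0.trans (map_zero φ.symm).symm)).trans (map_zero _).symm))
    have hgw : ∀ m, g m ∈ weightSpace k q (Ind (CA k q) M) μ' := fun m => by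
      have h1 := (mem_weightSpace k q _ μ' _).1 (unit_mem_weightSpace hμ' m)
      refine (mem_weightSpace k q _ μ' _).2 ?_
      change Dq.of k q .a • φ.symm _ = (μ' : k) • φ.symm _
      rw [← map_smul, h1, ← algebraMap_smul (Dq k q) (μ' : k), map_smul, algebraMap_smul]
    obtain ⟨i, rfl⟩ := mem_range_of_iSup_orbit_eq_top (iSup_orbit_ind hμ)
      (show μ' ∈ supp k q _ from (Submodule.ne_bot_iff _).2 ⟨_, hgw m', hg0⟩)
    have hrange : ∀ m, g m ∈ LinearMap.range (twistUnit (k := k) (q := q) M i) := fun m => by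
      have := hgw m
      rw [← indGr_eq_weightSpace hq hμ] at this
      exact this
    let ψ : M' →ₗ[CA k q] Twist (tauK k q ^ i) M :=
      (LinearEquiv.ofInjective _ (twistUnit_injective hq i)).symm.toLinearMap ∘ₗ
        g.codRestrict _ hrange
    have hψ : ψ ≠ 0 := fun h0 => hg0 (by
      have h1 : ψ m' = 0 := by rw [h0]; rfl
      have h2 := (LinearEquiv.map_eq_zero_iff
        (LinearEquiv.ofInjective _ (twistUnit_injective hq i)).symm).1 h1
      exact congrArg Subtype.val h2)
    exact ⟨i, ⟨LinearEquiv.ofBijective ψ (LinearMap.bijective_of_ne_zero hψ)⟩⟩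
  · rintro ⟨i, ⟨ε⟩⟩
    refine (nonempty_equiv_of_lift_ne_zero (twistUnit M i ∘ₗ ε.toLinearMap) (m := m')
      fun h0 => hm' ?_).map LinearEquiv.symm
    exact ε.injective ((twistUnit_injective hq i (h0.trans (map_zero _).symm)).trans
      (map_zero ε).symm)

section WeightSubmodule

variable {V : Type v} [AddCommGroup V] [Module k V]
  [Module (Dq k q) V] [IsScalarTower k (Dq k q) V]

variable (V) in
/-- A weight space as a `C(a, D_q)`-submodule. -/
def weightSubmodule (μ : kˣ) : Submodule (CA k q) V :=
  { weightSpace k q V μ with smul_mem' := fun t _ hx => CA_smul_mem_weightSpace t hx }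

/-- If `d n = x` with `n ≠ 0` and `x` both of weight `μ`, the parts of `d` of nonzero degree send
`n` to other weights, so the degree-zero part of `d` alone already sends `n` to `x`. -/
theorem isSimpleModule_weightSubmodule (hq : ∀ n : ℕ, 0 < n → q ^ n ≠ 1)
    [IsSimpleModule (Dq k q) V] {μ : kˣ} (hμ : μ ∈ supp k q V) :
    IsSimpleModule (CA k q) (weightSubmodule (q := q) V μ) := by
  rw [isSimpleModule_iff_toSpanSingleton_surjective]
  refine ⟨?_, fun n hn x => ?_⟩
  · obtain ⟨x, hx, hx0⟩ := Submodule.exists_mem_ne_zero_of_ne_bot hμ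
    exact ⟨⟨x, hx⟩, 0, fun h => hx0 (congrArg Subtype.val h)⟩
  · have hn0 : (n : V) ≠ 0 := fun h => hn (Subtype.ext h)
    obtain ⟨d, hd⟩ := IsSimpleModule.toSpanSingleton_surjective (Dq k q) hn0 (x : V)
    obtain ⟨t, ht, r, hr, rfl⟩ := Dq.exists_add_of_gr hq d
    have hd' : t • (n : V) + r • (n : V) = x := by rw [← add_smul]; exact hd
    have h1 : r • (n : V) ∈ ⨆ (j : ℤ) (_ : j ≠ 0), weightSpace k q V (q ^ j * μ) := by
      have hle : (⨆ (j : ℤ) (_ : j ≠ 0), Dq.gr k q j : Submodule k (Dq k q)) ≤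
          (⨆ (j : ℤ) (_ : j ≠ 0), weightSpace k q V (q ^ j * μ) : Submodule k V).comap
            ((LinearMap.toSpanSingleton (Dq k q) V (n : V)).restrictScalars k) :=
        iSup₂_le fun j hj d hd => Submodule.mem_iSup_of_mem j
          (Submodule.mem_iSup_of_mem hj (smul_mem_weightSpace hd n.2))
      exact hle hr
    have h2 : r • (n : V) ∈ weightSpace k q V (q ^ (0 : ℤ) * μ) := by
      rw [zpow_zero, one_mul, eq_sub_of_add_eq' hd']
      exact sub_mem x.2 (CA_smul_mem_weightSpace ⟨t, ht⟩ n.2)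
    have h0 := Submodule.disjoint_def.1 (iSupIndep_weightSpace_orbit (V := V) hq μ 0) _ h2 h1
    rw [h0, add_zero] at hd'
    exact ⟨⟨t, ht⟩, Subtype.ext hd'⟩

end WeightSubmodule

end InducedModules

end HeisenbergDouble

theorem mainTheorem11 (k : Type u) [Field k] [IsAlgClosed k] [CharZero k]
    (q : kˣ) (hq : ∀ n : ℕ, 0 < n → q ^ n ≠ 1) :
    -- the support is a single orbit, and all weight spaces are infinite-dimensional
    (∀ (V : Type v) [AddCommGroup V] [Module k V] [Module (Dq k q) V]
        [IsScalarTower k (Dq k q) V],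
      IsSimpleModule (Dq k q) V → IsAWeight k q V →
        (supp k q V).Nonempty ∧
        ∀ μ ∈ supp k q V,
          supp k q V = Set.range (fun i : ℤ => q ^ i * μ) ∧
          ¬ FiniteDimensional k (weightSpace k q V μ)) ∧
    -- the two centralizers are isomorphic
    Nonempty (CA k q ≃ₐ[k] CK k q) ∧
    -- modules induced from simple modules are simple `a`-weight modules
    (∀ (M : Type v) [AddCommGroup M] [Module (CA k q) M],
      IsSimpleModule (CA k q) M →
        IsSimpleModule (Dq k q) (Ind (CA k q) M) ∧ IsAWeight k q (Ind (CA k q) M)) ∧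
    -- every simple `a`-weight module is induced from a simple module
    (∀ (V : Type v) [AddCommGroup V] [Module k V] [Module (Dq k q) V]
        [IsScalarTower k (Dq k q) V],
      IsSimpleModule (Dq k q) V → IsAWeight k q V →
        ∃ (M : Type v) (_ : AddCommGroup M) (_ : Module (CA k q) M),
          IsSimpleModule (CA k q) M ∧ Nonempty (Ind (CA k q) M ≃ₗ[Dq k q] V)) ∧
    -- two induced modules are isomorphic iff the modules differ by a twist by a power of `τ_K`
    (∀ (M M' : Type v) [AddCommGroup M] [Module (CA k q) M] [AddCommGroup M']
        [Module (CA k q) M'],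
      IsSimpleModule (CA k q) M → IsSimpleModule (CA k q) M' →
        (Nonempty (Ind (CA k q) M ≃ₗ[Dq k q] Ind (CA k q) M') ↔
          ∃ i : ℤ, Nonempty (M' ≃ₗ[CA k q] Twist (tauK k q ^ i) M))) := by
  refine ⟨?_, Dq.nonempty_CA_equiv_CK k q, ?_, ?_, ?_⟩
  · intro V _ _ _ _ hV hw
    have : Nontrivial V := IsSimpleModule.nontrivial (Dq k q) V
    exact ⟨supp_nonempty hw, fun μ hμ =>
      ⟨supp_eq_range hμ, not_finiteDimensional_weightSpace hq hμ⟩⟩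
  · intro M _ _ hM
    obtain ⟨μ, hμ⟩ := exists_unit_smul_eq hq M
    exact ⟨isSimpleModule_ind hq hμ, isAWeight_ind hμ⟩
  · intro V _ _ _ _ hV hw
    have : Nontrivial V := IsSimpleModule.nontrivial (Dq k q) V
    obtain ⟨μ, hμ⟩ := supp_nonempty hw
    have hM := isSimpleModule_weightSubmodule hq hμ
    refine ⟨weightSubmodule (q := q) V μ, inferInstance, inferInstance, hM, ?_⟩
    -- Any scalar by which `a` acts suffices for simplicity of the induced module, so `ν` need not
    -- be compared with `μ`.
    obtain ⟨ν, hν⟩ := exists_unit_smul_eq hq (weightSubmodule (q := q) V μ)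
    have := isSimpleModule_ind hq hν
    obtain ⟨x, hx, hx0⟩ := Submodule.exists_mem_ne_zero_of_ne_bot hμ
    exact nonempty_equiv_of_lift_ne_zero (weightSubmodule (q := q) V μ).subtype
      (m := ⟨x, hx⟩) hx0
  · intro M M' _ _ _ _ hM hM'
    obtain ⟨μ, hμ⟩ := exists_unit_smul_eq hq M
    obtain ⟨μ', hμ'⟩ := exists_unit_smul_eq hq M'
    exact nonempty_ind_equiv_iff hq hμ hμ'
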